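/- **Theorem 4.** All tensor products of C*-algebras are maximal. For $n\ge 1$ let $\mathbb M_{2^n}$ be the algebra of complex $2^n\times 2^n$ matrices, and let $\mathcal M^{(n)}=\bigotimes_{i\in\mathbb Z}\mathbb M_{2^n}$ (the inductive limit of the finite tensor products; a copy of the CAR algebra). Let $S_n=\{q\in[0,\infty)^{2^n}:\sum_i q_i^2=1\}$ be the set of normalized Schmidt vectors, and for $q\in S_n$ put $|\phi_q\rangle=\sum_i q_i|ii\rangle\in\mathbb C^{2^n}\otimes\mathbb C^{2^n}$. Call a pair $r=(n,q)$ with $n\ge1$, $q\in S_n$ a register, put $\mathcal R_r=\mathcal M^{(n)}$, and let $$\mathcal A=\bigotimes_{r}^{\mathrm{fin}}\mathcal R_r$$ be the finitely supported tensor product over all registers, i.e. the C*-completion of the finite linear combinations of tensors $\bigotimes_r a_r$ with $a_r\in\mathcal R_r$ and $a_r=1$ for all but finitely many $r$. Alice's algebra and Bob's algebra are both $\mathcal A$. Then: 1. $\mathcal A$ is not separable. 2. For every register $r=(n,q)$ there is a state $s_r$ on $\mathcal R_r\otimes\mathcal R_r$ with $$s_r\Big(\bigotimes_i M_i\otimes\bigotimes_i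 M_i'\Big)=\prod_{i\le 0}\langle 00|M_i\otimes M_i'|00\rangle\prod_{i\ge 1}\langle\phi_q|M_i\otimes M_i'|\phi_q\rangle ,$$ where $|0\rangle$ denotes the first basis vector of $\mathbb C^{2^n}$, and there is a state $s=\bigotimes_r s_r$ (the catalyst) on $\mathcal A\otimes\mathcal A$, i.e. $s(\bigotimes_r a_r\otimes\bigotimes_r b_r)=\prod_r s_r(a_r\otimes b_r)$, for all finitely supported families. 3. For every register $r=(n,q)$ there are *-automorphisms $\pi_r$ (shift) and $\tau_r$ (swap) of $\mathcal A\otimes\mathbb M_{2^n}$ that fix all registers other than $r$, such that $\pi_r$ moves every observable at site $i\in\mathbb Z$ of register $r$ to site $i+1$ and fixes the external factor $\mathbb M_{2^n}$, while $\tau_r$ exchanges site $0$ of register $r$ with the external factor $\mathbb M_{2^n}$ and fixes all other sites of register $r$. 4. With the single catalyst $s$, every bipartite pure state of $2n$ qubits, for every $n\ge1$, is embezzled exactly. That is, every unit vector $|\phi\rangle\in\mathbb C^{2^n}\otimes\mathbb C^{2^n}$ can be written as $|\phi\rangle=(U\otimes V)|\phi_q\rangle$ with $q\in S_n$ and $U,V$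 unitary, and for every such representation, with $r=(n,q)$, $\mathrm{Ad}_U(x)=(1\otimes U)^*x(1\otimes U)$ and $$\alpha_{A,\phi}=\pi_r\circ\tau_r\circ \mathrm{Ad}_U,\qquad \alpha_{B,\phi}=\pi_r\circ\tau_r\circ \mathrm{Ad}_V,$$ one has, on $(\mathcal A\otimes\mathbb M_{2^n})\otimes(\mathcal A\otimes\mathbb M_{2^n})$ (tensor factors reordered as needed), for all $X$, $$(s\otimes s_0\otimes s_0)\big((\alpha_{A,\phi}\otimes\alpha_{B,\phi})(X)\big)=(s\otimes s_\phi)(X),$$ where $s_0(M)=\langle 0|M|0\rangle$ and $s_\phi(M)=\langle\phi|M|\phi\rangle$; in particular the product states $s\otimes s_0\otimes s_0$, $s\otimes s_\phi$ and the *-automorphism $\alpha_{A,\phi}\otimes\alpha_{B,\phi}$ exist. -/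

import Mathlib

open scoped Matrix.Norms.L2Operator TensorProduct ComplexOrder Kronecker Matrix

noncomputable section

namespace Embezzlement

/-! ## C*-seminorms and the C*-algebra obtained by completion -/

/-- A C*-seminorm on a complex unital *-algebra. -/
structure CStarSeminorm (P : Type*) [Ring P] [StarRing P] [Algebra ℂ P] extends
    Seminorm ℂ P where
  mul_le' : ∀ x y, toFun (x * y) ≤ toFun x * toFun y
  star_mul_self' : ∀ x, toFun (star x * x) = toFun x * toFun x

namespace CStarSeminorm

variable {P : Type*} [Ring P] [StarRing P] [Algebra ℂ P]

instance : CoeFun (CStarSeminorm P) fun _ => P → ℝ := ⟨fun N => N.toSeminorm⟩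

theorem nonneg (N : CStarSeminorm P) (x : P) : 0 ≤ N x := apply_nonneg N.toSeminorm x

theorem mul_le (N : CStarSeminorm P) (x y : P) : N (x * y) ≤ N x * N y := N.mul_le' x y

theorem star_mul_self (N : CStarSeminorm P) (x : P) : N (star x * x) = N x * N x :=
  N.star_mul_self' x

theorem le_star (N : CStarSeminorm P) (x : P) : N x ≤ N (star x) := by
  rcases (N.nonneg x).eq_or_lt with h | h
  · rw [← h]; exact N.nonneg _
  · have h1 := N.mul_le (star x) x
    rw [N.star_mul_self] at h1
    exact le_of_mul_le_mul_right h1 h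

theorem map_star (N : CStarSeminorm P) (x : P) : N (star x) = N x :=
  le_antisymm (by simpa using N.le_star (star x)) (N.le_star x)

/-- The zero C*-seminorm. -/
def zero : CStarSeminorm P where
  toSeminorm := 0
  mul_le' x y := by change (0 : ℝ) ≤ 0 * 0; simp
  star_mul_self' x := by change (0 : ℝ) = 0 * 0; simp

/-- The pointwise supremum of a pointwise bounded nonempty set of C*-seminorms. -/
def sup (S : Set (CStarSeminorm P)) (hne : S.Nonempty)
    (hS : ∀ x, BddAbove (Set.range fun N : S => N.1 x)) : CStarSeminorm P :=
  haveI : Nonempty S := hne.to_subtype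
  { toFun := fun x => ⨆ N : S, N.1 x
    map_zero' := by simp
    add_le' := fun x y => ciSup_le fun N =>
      (map_add_le_add N.1.toSeminorm x y).trans
        (add_le_add (le_ciSup (hS x) N) (le_ciSup (hS y) N))
    neg' := fun x => by simp
    smul' := fun c x => by
      simp only [map_smul_eq_mul]
      exact (Real.mul_iSup_of_nonneg (norm_nonneg c) _).symm
    mul_le' := fun x y => ciSup_le fun N =>
      (N.1.mul_le x y).trans
        (mul_le_mul (le_ciSup (hS x) N) (le_ciSup (hS y) N) (N.1.nonneg y)
          ((N.1.nonneg x).trans (le_ciSup (hS x) N)))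
    star_mul_self' := fun x => by
      refine le_antisymm (ciSup_le fun N => ?_) ?_
      · rw [N.1.star_mul_self]
        exact mul_self_le_mul_self (N.1.nonneg x) (le_ciSup (hS x) N)
      · have h0 : 0 ≤ ⨆ N : S, N.1 (star x * x) := Real.iSup_nonneg fun N => N.1.nonneg _
        have h : (⨆ N : S, N.1 x) ≤ Real.sqrt (⨆ N : S, N.1 (star x * x)) :=
          ciSup_le fun N => Real.le_sqrt_of_sq_le (by
            rw [sq, ← N.1.star_mul_self]
            exact le_ciSup (hS (star x * x)) N)
        have h1 : 0 ≤ ⨆ N : S, N.1 x := Real.iSup_nonneg fun N => N.1.nonneg _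
        calc _ ≤ Real.sqrt (⨆ N : S, N.1 (star x * x)) * Real.sqrt (⨆ N : S, N.1 (star x * x)) :=
              mul_self_le_mul_self h1 h
          _ = _ := Real.mul_self_sqrt h0 }

/-- The *-algebra `P`, regarded as a seminormed algebra through `N`. -/
def Carrier (_N : CStarSeminorm P) : Type _ := P

variable (N : CStarSeminorm P)

instance : Ring N.Carrier := inferInstanceAs (Ring P)
instance : StarRing N.Carrier := inferInstanceAs (StarRing P)
instance : Algebra ℂ N.Carrier := inferInstanceAs (Algebra ℂ P)
instance [StarModule ℂ P] : StarModule ℂ N.Carrier := inferInstanceAs (StarModule ℂ P)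

instance : SeminormedRing N.Carrier :=
  RingSeminorm.toSeminormedRing (R := N.Carrier)
    { N.toSeminorm.toAddGroupSeminorm with mul_le' := N.mul_le' }

theorem norm_def (x : N.Carrier) : ‖x‖ = N x := rfl

instance : NormedAlgebra ℂ N.Carrier where
  norm_smul_le c x := (map_smul_eq_mul N.toSeminorm c x).le

instance : NormedStarGroup N.Carrier where
  norm_star_le x := (N.map_star x).le

/-- The Hausdorff completion of `P` with respect to the C*-seminorm `N`. -/
def Completion : Type _ := UniformSpace.Completion N.Carrier

instance : NormedRing N.Completion :=
  inferInstanceAs (NormedRing (UniformSpace.Completion N.Carrier))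
instance : CompleteSpace N.Completion :=
  inferInstanceAs (CompleteSpace (UniformSpace.Completion N.Carrier))
instance : Algebra ℂ N.Completion :=
  inferInstanceAs (Algebra ℂ (UniformSpace.Completion N.Carrier))

/-- The canonical map of `P` into its completion. -/
def toCompletion (x : P) : N.Completion :=
  UniformSpace.Completion.coe' (α := N.Carrier) x

instance : NormedAlgebra ℂ N.Completion where
  norm_smul_le c x := norm_smul_le (β := UniformSpace.Completion N.Carrier) c x

instance : Star N.Completion := ⟨UniformSpace.Completion.map (star : N.Carrier → N.Carrier)⟩

theorem uniformContinuous_star : UniformContinuous (star : N.Carrier → N.Carrier) :=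
  (LipschitzWith.of_dist_le_mul (K := 1) fun x y => by
    rw [dist_eq_norm, dist_eq_norm, ← star_sub, norm_star]; simp).uniformContinuous

theorem star_toCompletion (x : P) : star (N.toCompletion x) = N.toCompletion (star x) :=
  UniformSpace.Completion.map_coe N.uniformContinuous_star _

theorem continuous_star : Continuous (star : N.Completion → N.Completion) :=
  UniformSpace.Completion.continuous_map

theorem toCompletion_add (x y : P) :
    N.toCompletion (x + y) = N.toCompletion x + N.toCompletion y :=
  UniformSpace.Completion.coe_add (α := N.Carrier) x y

theorem toCompletion_mul (x y : P) :
    N.toCompletion (x * y) = N.toCompletion x * N.toCompletion y :=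
  UniformSpace.Completion.coe_mul (α := N.Carrier) x y

theorem toCompletion_smul (c : ℂ) (x : P) :
    N.toCompletion (c • x) = c • N.toCompletion x :=
  UniformSpace.Completion.coe_smul (X := N.Carrier) c x

theorem toCompletion_one : N.toCompletion 1 = 1 := rfl

theorem norm_toCompletion (x : P) : ‖N.toCompletion x‖ = N x :=
  UniformSpace.Completion.norm_coe (E := N.Carrier) x

theorem denseRange_toCompletion : DenseRange N.toCompletion :=
  UniformSpace.Completion.denseRange_coe (α := N.Carrier)

theorem induction {p : N.Completion → Prop} (x : N.Completion) (hp : IsClosed {x | p x})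
    (h : ∀ a : P, p (N.toCompletion a)) : p x :=
  UniformSpace.Completion.induction_on (α := N.Carrier) x hp h

instance : StarRing N.Completion where
  star_involutive x := by
    have hc : Continuous fun x : N.Completion => star (star x) :=
      N.continuous_star.comp N.continuous_star
    refine N.induction (p := fun x => star (star x) = x) x (isClosed_eq hc continuous_id)
      fun a => ?_
    rw [star_toCompletion, star_toCompletion, star_star]
  star_mul x y := by
    have hs := N.continuous_star
    refine N.induction (p := fun x => star (x * y) = star y * star x) x
      (isClosed_eq (hs.comp (by fun_prop)) (by fun_prop)) fun a => ?_
    refine N.induction (p := fun y => star (N.toCompletion a * y) = star y * star (N.toCompletion a))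
      y (isClosed_eq (hs.comp (by fun_prop)) (by fun_prop)) fun b => ?_
    rw [← toCompletion_mul, star_toCompletion, star_mul, toCompletion_mul, star_toCompletion,
      star_toCompletion]
  star_add x y := by
    have hs := N.continuous_star
    refine N.induction (p := fun x => star (x + y) = star x + star y) x
      (isClosed_eq (hs.comp (by fun_prop)) (by fun_prop)) fun a => ?_
    refine N.induction (p := fun y => star (N.toCompletion a + y) = star (N.toCompletion a) + star y)
      y (isClosed_eq (hs.comp (by fun_prop)) (by fun_prop)) fun b => ?_
    rw [← toCompletion_add, star_toCompletion, star_add, toCompletion_add, star_toCompletion,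
      star_toCompletion]

instance : CStarRing N.Completion where
  norm_mul_self_le x := by
    have hs := N.continuous_star
    refine N.induction (p := fun x => ‖x‖ * ‖x‖ ≤ ‖star x * x‖) x
      (isClosed_le (by fun_prop) (by fun_prop)) fun a => ?_
    rw [star_toCompletion, ← toCompletion_mul, norm_toCompletion, norm_toCompletion,
      star_mul_self]

instance [StarModule ℂ P] : StarModule ℂ N.Completion where
  star_smul c x := by
    have hs := N.continuous_star
    have h1 : Continuous fun x : N.Completion => star (c • x) := hs.comp (continuous_const_smul c)
    have h2 : Continuous fun x : N.Completion => star c • star x :=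
      (continuous_const_smul (star c)).comp hs
    refine N.induction (p := fun x => star (c • x) = star c • star x) x
      (isClosed_eq h1 h2) fun a => ?_
    rw [← toCompletion_smul, star_toCompletion, star_smul, toCompletion_smul, star_toCompletion]

instance [StarModule ℂ P] : CStarAlgebra N.Completion where

end CStarSeminorm

/-! ## The maximal tensor product of two C*-algebras -/

section MaxTensor

variable (A B : Type*) [CStarAlgebra A] [CStarAlgebra B]

/-- All C*-seminorms on the algebraic tensor product. The bound on elementary tensors holds
automatically for C*-seminorms; it is recorded to make the supremum visibly finite. -/
def tensorSeminorms : Set (CStarSeminorm (A ⊗[ℂ] B)) :=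
  {N | ∀ a b, N (a ⊗ₜ[ℂ] b) ≤ ‖a‖ * ‖b‖}

theorem tensorSeminorms_nonempty : (tensorSeminorms A B).Nonempty :=
  ⟨CStarSeminorm.zero, fun a b => mul_nonneg (norm_nonneg a) (norm_nonneg b)⟩

theorem tensorSeminorms_bddAbove (x : A ⊗[ℂ] B) :
    BddAbove (Set.range fun N : tensorSeminorms A B => N.1 x) := by
  induction x using TensorProduct.induction_on with
  | zero => exact ⟨0, by rintro _ ⟨N, rfl⟩; simp⟩
  | tmul a b => exact ⟨‖a‖ * ‖b‖, by rintro _ ⟨N, rfl⟩; exact N.2 a b⟩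
  | add x y hx hy =>
    obtain ⟨c, hc⟩ := hx
    obtain ⟨d, hd⟩ := hy
    refine ⟨c + d, ?_⟩
    rintro _ ⟨N, rfl⟩
    exact (map_add_le_add N.1.toSeminorm x y).trans (add_le_add (hc ⟨N, rfl⟩) (hd ⟨N, rfl⟩))

/-- The maximal C*-norm: the largest C*-seminorm on the algebraic tensor product. -/
def maxSeminorm : CStarSeminorm (A ⊗[ℂ] B) :=
  CStarSeminorm.sup (tensorSeminorms A B) (tensorSeminorms_nonempty A B)
    (tensorSeminorms_bddAbove A B)

/-- The maximal tensor product of two unital C*-algebras. -/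
def MaxTensor : Type _ := (maxSeminorm A B).Completion

instance : CStarAlgebra (MaxTensor A B) :=
  inferInstanceAs (CStarAlgebra (maxSeminorm A B).Completion)

variable {A B}

/-- The elementary tensor `a ⊗ b` in the maximal tensor product. -/
def tmul (a : A) (b : B) : MaxTensor A B := (maxSeminorm A B).toCompletion (a ⊗ₜ[ℂ] b)

theorem tmul_mul (a a' : A) (b b' : B) : tmul a b * tmul a' b' = tmul (a * a') (b * b') := by
  unfold tmul
  rw [← Algebra.TensorProduct.tmul_mul_tmul]
  exact ((maxSeminorm A B).toCompletion_mul _ _).symm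

theorem star_tmul (a : A) (b : B) : star (tmul a b) = tmul (star a) (star b) :=
  (maxSeminorm A B).star_toCompletion _

theorem tmul_one_one : tmul (1 : A) (1 : B) = 1 := rfl

end MaxTensor

/-! ## The finitely supported tensor product of a family of C*-algebras -/

section FinTensor

variable {ι : Type*} (A : ι → Type*) [∀ i, CStarAlgebra (A i)]

/-- Families `(aᵢ)` with `aᵢ = 1` for all but finitely many `i`. -/
def FinSupp : Submonoid (∀ i, A i) where
  carrier := {a | {i | a i ≠ 1}.Finite}
  one_mem' := by simp
  mul_mem' {a b} ha hb := (ha.union hb).subset fun i hi => by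
    by_contra h
    simp only [Set.mem_union, Set.mem_ofPred_eq, not_or, not_not] at h
    exact hi (by simp [h.1, h.2])

variable {A}

namespace FinSupp

instance : StarMul (FinSupp A) where
  star a := ⟨star a.1, a.2.subset fun i hi h => hi (by simp [h])⟩
  star_involutive a := Subtype.ext (star_star a.1)
  star_mul a b := Subtype.ext (star_mul a.1 b.1)

open Classical in
/-- Replace the `i`-th entry of a finitely supported family. -/
def update (a : FinSupp A) (i : ι) (x : A i) : FinSupp A :=
  ⟨Function.update a.1 i x, (a.2.union (Set.finite_singleton i)).subset fun j hj => by
    by_cases h : j = i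
    · exact Or.inr h
    · left
      simpa [Function.update_of_ne h] using hj⟩

end FinSupp

variable (A)

/-- Formal finite linear combinations of the tensors `⨂ aᵢ`, where `aᵢ = 1` for all but finitely
many `i`, with `(⨂ aᵢ)(⨂ bᵢ) = ⨂ aᵢbᵢ` and `(⨂ aᵢ)* = ⨂ aᵢ*`. -/
abbrev FormalTensor : Type _ := MonoidAlgebra ℂ (FinSupp A)

variable {A}

/-- The formal tensor `⨂ aᵢ`. -/
def formal (a : FinSupp A) : FormalTensor A := MonoidAlgebra.single a 1

theorem formal_mul (a b : FinSupp A) : formal (a * b) = formal a * formal b := by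
  simp [formal, MonoidAlgebra.single_mul_single]

theorem formal_one : formal (1 : FinSupp A) = 1 := rfl

theorem formal_induction {p : FormalTensor A → Prop} (x : FormalTensor A)
    (h : ∀ a, p (formal a)) (hadd : ∀ x y, p x → p y → p (x + y))
    (hsmul : ∀ (c : ℂ) x, p x → p (c • x)) : p x :=
  MonoidAlgebra.induction_on (motive := p) x h hadd hsmul

/-- The involution on formal tensors. -/
def formalStar (x : FormalTensor A) : FormalTensor A :=
  (MonoidAlgebra.coeff x).sum fun a c => MonoidAlgebra.single (star a) (star c)

theorem formalStar_single (a : FinSupp A) (c : ℂ) :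
    formalStar (MonoidAlgebra.single a c : FormalTensor A) =
      (MonoidAlgebra.single (star a) (star c) : FormalTensor A) := by
  unfold formalStar
  rw [MonoidAlgebra.coeff_single, Finsupp.sum_single_index]
  simp

theorem formalStar_add (x y : FormalTensor A) :
    formalStar (x + y) = formalStar x + formalStar y :=
  Finsupp.sum_add_index' (h := fun a c =>
    (MonoidAlgebra.single (star a) (star c) : FormalTensor A))
    (by simp) (by simp)

theorem formal_ind_single {p : FormalTensor A → Prop} (x : FormalTensor A)
    (h : ∀ a c, p (MonoidAlgebra.single a c : FormalTensor A))
    (hadd : ∀ x y, p x → p y → p (x + y)) : p x := by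
  refine MonoidAlgebra.induction_linear (motive := p) x ?_ hadd h
  simpa using h 1 0

instance : StarRing (FormalTensor A) where
  star := formalStar
  star_involutive x := by
    change formalStar (formalStar x) = x
    refine formal_ind_single (p := fun x => formalStar (formalStar x) = x) x (fun a c => ?_)
      fun x y hx hy => ?_
    · rw [formalStar_single, formalStar_single, star_star, star_star]
    · rw [formalStar_add, formalStar_add, hx, hy]
  star_mul x y := by
    change formalStar (x * y) = formalStar y * formalStar x
    refine formal_ind_single (p := fun x => formalStar (x * y) = formalStar y * formalStar x) x
      (fun a c => ?_) fun x x' hx hy => ?_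
    · refine formal_ind_single (p := fun y => formalStar
        ((MonoidAlgebra.single a c : FormalTensor A) * y) =
          formalStar y * formalStar (MonoidAlgebra.single a c : FormalTensor A)) y
        (fun b d => ?_) fun x x' hx hy => ?_
      · rw [formalStar_single, formalStar_single]
        refine (congrArg formalStar (MonoidAlgebra.single_mul_single ..)).trans ?_
        rw [formalStar_single, star_mul, star_mul]
        exact (MonoidAlgebra.single_mul_single ..).symm
      · rw [formalStar_add, add_mul, ← hx, ← hy, ← formalStar_add]
        exact congrArg formalStar (mul_add (R := FormalTensor A) _ _ _)
    · rw [add_mul, formalStar_add, formalStar_add, mul_add, hx, hy]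
  star_add := formalStar_add

theorem star_formal (a : FinSupp A) : star (formal a) = formal (star a) := by
  refine (formalStar_single a 1).trans ?_
  rw [star_one]; rfl

instance : StarModule ℂ (FormalTensor A) where
  star_smul c x := by
    refine formal_ind_single (p := fun x => star (c • x) = star c • star x) x (fun a d => ?_)
      fun x y hx hy => ?_
    · change formalStar (c • MonoidAlgebra.single a d) = star c • formalStar (MonoidAlgebra.single a d)
      rw [MonoidAlgebra.smul_single, formalStar_single, formalStar_single,
        MonoidAlgebra.smul_single, smul_eq_mul, smul_eq_mul, star_mul, mul_comm]
    · rw [smul_add, star_add, star_add, hx, hy, smul_add]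

variable (A)

/-- All C*-seminorms on the algebraic finitely supported tensor product, that is, the C*-seminorms
on formal tensors that vanish on the relations making `⨂ aᵢ` linear in each entry. The bound on
elementary tensors holds automatically; it is recorded to make the supremum visibly finite. -/
def finTensorSeminorms : Set (CStarSeminorm (FormalTensor A)) :=
  {N | (∀ (a : FinSupp A) (i : ι) (x y : A i),
          N (formal (FinSupp.update a i (x + y)) - formal (FinSupp.update a i x) - formal (FinSupp.update a i y)) = 0) ∧
       (∀ (a : FinSupp A) (i : ι) (c : ℂ) (x : A i),
          N (formal (FinSupp.update a i (c • x)) - c • formal (FinSupp.update a i x)) = 0) ∧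
       (∀ a : FinSupp A, N (formal a) ≤ ∏ i ∈ a.2.toFinset, ‖a.1 i‖)}

theorem finTensorSeminorms_nonempty : (finTensorSeminorms A).Nonempty :=
  ⟨CStarSeminorm.zero, fun _ _ _ _ => rfl, fun _ _ _ _ => rfl,
    fun a => Finset.prod_nonneg fun i _ => norm_nonneg (a.1 i)⟩

theorem finTensorSeminorms_bddAbove (x : FormalTensor A) :
    BddAbove (Set.range fun N : finTensorSeminorms A => N.1 x) := by
  refine formal_induction (p := fun x => BddAbove (Set.range fun N : finTensorSeminorms A => N.1 x))
    x (fun a => ?_) (fun x y hx hy => ?_) fun c x hx => ?_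
  · exact ⟨∏ i ∈ a.2.toFinset, ‖a.1 i‖, by rintro _ ⟨N, rfl⟩; exact N.2.2.2 a⟩
  · obtain ⟨c, hc⟩ := hx
    obtain ⟨d, hd⟩ := hy
    refine ⟨c + d, ?_⟩
    rintro _ ⟨N, rfl⟩
    exact (map_add_le_add N.1.toSeminorm x y).trans (add_le_add (hc ⟨N, rfl⟩) (hd ⟨N, rfl⟩))
  · obtain ⟨d, hd⟩ := hx
    refine ⟨‖c‖ * d, ?_⟩
    rintro _ ⟨N, rfl⟩
    exact (map_smul_eq_mul N.1.toSeminorm c x).le.trans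
      (mul_le_mul_of_nonneg_left (hd ⟨N, rfl⟩) (norm_nonneg c))

/-- The (maximal) C*-norm on the algebraic finitely supported tensor product. -/
def finTensorSeminorm : CStarSeminorm (FormalTensor A) :=
  CStarSeminorm.sup (finTensorSeminorms A) (finTensorSeminorms_nonempty A)
    (finTensorSeminorms_bddAbove A)

/-- The finitely supported tensor product of a family of unital C*-algebras: the completion of the
finite linear combinations of the tensors `⨂ aᵢ` with `aᵢ = 1` for all but finitely many `i`
(equivalently, the inductive limit of the finite maximal tensor products under `a ↦ a ⊗ 1`). -/
def FinTensor : Type _ := (finTensorSeminorm A).Completion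

instance : CStarAlgebra (FinTensor A) :=
  inferInstanceAs (CStarAlgebra (finTensorSeminorm A).Completion)

variable {A}

/-- The elementary tensor `⨂ aᵢ`. -/
def tprod (a : FinSupp A) : FinTensor A := (finTensorSeminorm A).toCompletion (formal a)

/-- The embedding of the `i`-th factor, `x ↦ x ⊗ 1 ⊗ 1 ⊗ ⋯`. -/
def embed (i : ι) (x : A i) : FinTensor A := tprod (FinSupp.update 1 i x)

end FinTensor

/-! ## States -/

/-- A state on a unital C*-algebra: a positive linear functional with value `1` at `1`. -/
structure CState (A : Type*) [CStarAlgebra A] where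
  toFun : A →ₗ[ℂ] ℂ
  nonneg : ∀ a, 0 ≤ toFun (star a * a)
  map_one : toFun 1 = 1

instance (A : Type*) [CStarAlgebra A] : CoeFun (CState A) fun _ => A → ℂ := ⟨fun s => s.toFun⟩

/-! ## Qubits -/

/-- `M_{2^n}`, the observables of `n` qubits, with the operator norm. -/
abbrev Mat (n : ℕ) : Type := Matrix (Fin (2 ^ n)) (Fin (2 ^ n)) ℂ

/-- Vectors of `ℂ^{2^n} ⊗ ℂ^{2^n}`, in coordinates with respect to the basis `|ij⟩`. -/
abbrev BiVec (n : ℕ) : Type := Fin (2 ^ n) × Fin (2 ^ n) → ℂ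

/-- `⟨φ| M ⊗ M' |φ⟩`. -/
def expect {n : ℕ} (φ : BiVec n) (M M' : Mat n) : ℂ := star φ ⬝ᵥ ((M ⊗ₖ M') *ᵥ φ)

/-- `s₀(M) = ⟨0| M |0⟩`, with `|0⟩` the first basis vector `|0…0⟩`. -/
def expectZero {n : ℕ} (M : Mat n) : ℂ := M 0 0

/-- Normalized Schmidt vectors of `2n`-qubit bipartite states. -/
def SchmidtVec (n : ℕ) : Type :=
  {q : Fin (2 ^ n) → ℝ // (∀ i, 0 ≤ q i) ∧ ∑ i, q i ^ 2 = 1}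

/-- `|φ_q⟩ = ∑ᵢ qᵢ |ii⟩`. -/
def SchmidtVec.ket {n : ℕ} (q : SchmidtVec n) : BiVec n :=
  fun p => if p.1 = p.2 then (q.1 p.1 : ℂ) else 0

/-- `(U ⊗ V)|φ⟩`. -/
def localRotate {n : ℕ} (U V : Mat n) (φ : BiVec n) : BiVec n := (U ⊗ₖ V) *ᵥ φ

/-! ## Embezzlement in the C*-model -/

section Embezzle

variable {A B : Type*} [CStarAlgebra A] [CStarAlgebra B] {n : ℕ}

/-- With catalyst `s` on `A ⊗ B`, the local *-automorphisms `α` of `A ⊗ M_{2^n}` (Alice) and `β` of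
`B ⊗ M_{2^n}` (Bob) exactly embezzle `φ`: on the joint system `(A ⊗ M_{2^n}) ⊗ (B ⊗ M_{2^n})`,
`(s ⊗ s₀ ⊗ s₀)((α ⊗ β)(X)) = (s ⊗ s_φ)(X)` for every `X`. Here `γ = α ⊗ β`, `ω₀ = s ⊗ s₀ ⊗ s₀` and
`ω = s ⊗ s_φ` are determined by their values on elementary tensors, whose span is dense. -/
def Embezzles (s : CState (MaxTensor A B)) (φ : BiVec n)
    (α : MaxTensor A (Mat n) ≃⋆ₐ[ℂ] MaxTensor A (Mat n))
    (β : MaxTensor B (Mat n) ≃⋆ₐ[ℂ] MaxTensor B (Mat n)) : Prop :=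
  ∃ (γ : MaxTensor (MaxTensor A (Mat n)) (MaxTensor B (Mat n)) ≃⋆ₐ[ℂ]
      MaxTensor (MaxTensor A (Mat n)) (MaxTensor B (Mat n)))
    (ω₀ ω : CState (MaxTensor (MaxTensor A (Mat n)) (MaxTensor B (Mat n)))),
    (∀ x y, γ (tmul x y) = tmul (α x) (β y)) ∧
    (∀ a M b M', ω₀ (tmul (tmul a M) (tmul b M')) = s (tmul a b) * (expectZero M * expectZero M')) ∧
    (∀ a M b M', ω (tmul (tmul a M) (tmul b M')) = s (tmul a b) * expect φ M M') ∧
    ∀ X, ω₀ (γ X) = ω X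

/-- The *-automorphism `x ↦ (1 ⊗ U)* x (1 ⊗ U)` of `A ⊗ M_{2^n}`: in the Heisenberg picture, the
unitary `U` applied to the external `n` qubits. -/
def applyUnitary (A : Type*) [CStarAlgebra A] (U : Matrix.unitaryGroup (Fin (2 ^ n)) ℂ) :
    MaxTensor A (Mat n) ≃⋆ₐ[ℂ] MaxTensor A (Mat n) :=
  Unitary.conjStarAlgAut ℂ (MaxTensor A (Mat n)) ⟨tmul 1 (star U.1), by
    have h1 : star U.1 * U.1 = 1 := Matrix.mem_unitaryGroup_iff'.1 U.2
    have h2 : U.1 * star U.1 = 1 := Matrix.mem_unitaryGroup_iff.1 U.2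
    rw [Unitary.mem_iff, star_tmul, tmul_mul, tmul_mul, star_star, star_one, one_mul, h1, h2,
      tmul_one_one]
    exact ⟨rfl, rfl⟩⟩

end Embezzle

/-! ## The catalyst -/

/-- The register algebra `⨂_{i ∈ ℤ} M_{2^n}`, a copy of the CAR algebra when `n ≥ 1`. -/
abbrev RegAlg (n : ℕ) : Type := FinTensor fun _ : ℤ => Mat n

/-- Registers: one for every `n ≥ 1` and every normalized Schmidt vector of `2n`-qubit states. -/
abbrev Register : Type := Σ n : ℕ+, SchmidtVec n

/-- Alice's algebra, and also Bob's: the finitely supported tensor product of all registers. -/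
abbrev Hotel : Type := FinTensor fun r : Register => RegAlg r.1

/-- `ω` is the state `s_q` of the register of `q`: `|00⟩` on the sites `i ≤ 0` and `|φ_q⟩` on the
sites `i ≥ 1`. -/
def IsRegisterState {n : ℕ} (q : SchmidtVec n) (ω : CState (MaxTensor (RegAlg n) (RegAlg n))) :
    Prop :=
  ∀ a b : FinSupp fun _ : ℤ => Mat n, ω (tmul (tprod a) (tprod b)) =
    ∏ᶠ i : ℤ, if i ≤ 0 then expectZero (a.1 i) * expectZero (b.1 i)
      else expect q.ket (a.1 i) (b.1 i)

/-- `s` is the product over all registers of the register states. -/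
def IsCatalyst (s : CState (MaxTensor Hotel Hotel)) : Prop :=
  ∃ ω : ∀ r : Register, CState (MaxTensor (RegAlg r.1) (RegAlg r.1)),
    (∀ r, IsRegisterState r.2 (ω r)) ∧
    ∀ a b : FinSupp fun r : Register => RegAlg r.1,
      s (tmul (tprod a) (tprod b)) = ∏ᶠ r, ω r (tmul (a.1 r) (b.1 r))

/-- The observable `M` at site `i` of register `r`. -/
def site (r : Register) (i : ℤ) (M : Mat r.1) : Hotel :=
  embed (A := fun r : Register => RegAlg r.1) r (embed (A := fun _ : ℤ => Mat r.1) i M)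

/-- Shift of register `r` by one site; all other registers and the external qubits are fixed. -/
def IsShift (r : Register)
    (π : MaxTensor Hotel (Mat r.1) ≃⋆ₐ[ℂ] MaxTensor Hotel (Mat r.1)) : Prop :=
  (∀ r' ≠ r, ∀ a : RegAlg r'.1,
    π (tmul (embed (A := fun r : Register => RegAlg r.1) r' a) 1) =
      tmul (embed (A := fun r : Register => RegAlg r.1) r' a) 1) ∧
  (∀ i M, π (tmul (site r i M) 1) = tmul (site r (i + 1) M) 1) ∧
  (∀ M, π (tmul 1 M) = tmul 1 M)

/-- Swap of site `0` of register `r` with the external qubits; everything else is fixed. -/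
def IsSwap (r : Register)
    (τ : MaxTensor Hotel (Mat r.1) ≃⋆ₐ[ℂ] MaxTensor Hotel (Mat r.1)) : Prop :=
  (∀ r' ≠ r, ∀ a : RegAlg r'.1,
    τ (tmul (embed (A := fun r : Register => RegAlg r.1) r' a) 1) =
      tmul (embed (A := fun r : Register => RegAlg r.1) r' a) 1) ∧
  (∀ i ≠ 0, ∀ M, τ (tmul (site r i M) 1) = tmul (site r i M) 1) ∧
  (∀ M, τ (tmul (site r 0 M) 1) = tmul 1 M) ∧
  (∀ M, τ (tmul 1 M) = tmul (site r 0 M) 1)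

end Embezzlement

end

open Embezzlement

open scoped Matrix.Norms.L2Operator TensorProduct ComplexOrder Kronecker Matrix

noncomputable section

/-! Embezzlement here is Hilbert's hotel. The register of a Schmidt vector `q` carries `|00⟩` at
every site `i ≤ 0` and `|φ_q⟩` at every site `i ≥ 1`. In the Heisenberg picture the swap puts the
external observables `M`, `M'` at site 0 and takes the old entries of site 0 outside; the shift then
moves the register one step up. The new pair now sits at site 1, where it is evaluated in `φ_q`. The
pair taken outside is evaluated in `|00⟩`, exactly as it was at site 0. For every `i ≠ 0` the sites
`i` and `i + 1` carry the same vector, so nothing else changes. This is `registerState_shift`; the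
other registers contribute an unchanged factor (`catalyst_update`). Conjugation by `U` and `V` turns
`φ_q` into `(U ⊗ V)φ_q` (`expect_localRotate`), and the singular value decomposition brings every
unit vector into this form. One register for each `q` therefore makes a single catalyst serve all
states.

The price is non-separability: there are uncountably many registers, and a product state shows that
the same projection placed in two different registers gives elements at distance at least 1.

The analytic work is the existence of homomorphisms and states on maximal completions. A compatible
*-homomorphism from an algebraic tensor product to a C*-algebra defines one of the C*-seminorms in
the supremum, so it is bounded by the maximal norm and extends. For states, the product functional
on formal tensors is positive by the Schur product theorem (`posSemidef_prod`), and the operator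
norm in its GNS representation is again one of the seminorms in the supremum
(`gnsSeminorm_prodFunctional_mem`), which bounds the functional. All other states are product states
or vector states pulled back along *-homomorphisms. -/

namespace Embezzlement

/-! ### Extending homomorphisms and functionals to the completion -/

namespace CStarSeminorm

variable {P : Type*} [Ring P] [StarRing P] [Algebra ℂ P]

/-- The C*-seminorm `x ↦ ‖h x‖` of a representation `h`. -/
def ofStarAlgHom {C : Type*} [CStarAlgebra C] (h : P →⋆ₐ[ℂ] C) : CStarSeminorm P where
  toSeminorm := (normSeminorm ℂ C).comp h.toAlgHom.toLinearMap
  mul_le' x y := by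
    change ‖h (x * y)‖ ≤ ‖h x‖ * ‖h y‖
    rw [map_mul]; exact norm_mul_le _ _
  star_mul_self' x := by
    change ‖h (star x * x)‖ = ‖h x‖ * ‖h x‖
    rw [map_mul, StarHomClass.map_star h, CStarRing.norm_star_mul_self]

theorem ofStarAlgHom_apply {C : Type*} [CStarAlgebra C] (h : P →⋆ₐ[ℂ] C) (x : P) :
    ofStarAlgHom h x = ‖h x‖ := rfl

theorem le_sup {S : Set (CStarSeminorm P)} {hne : S.Nonempty}
    {hS : ∀ x, BddAbove (Set.range fun N : S => N.1 x)} {M : CStarSeminorm P} (hM : M ∈ S) (x : P) :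
    M x ≤ sup S hne hS x :=
  le_ciSup (hS x) ⟨M, hM⟩

variable (N : CStarSeminorm P)

/-- The canonical map into the completion as a continuous linear map. -/
def toCompletionL : N.Carrier →L[ℂ] N.Completion :=
  LinearMap.mkContinuous
    { toFun := N.toCompletion
      map_add' := N.toCompletion_add
      map_smul' := N.toCompletion_smul } 1
    fun x => by
      rw [one_mul]; exact (N.norm_toCompletion x).le

theorem isUniformInducing_toCompletionL : IsUniformInducing N.toCompletionL :=
  (AddMonoidHomClass.isometry_of_norm N.toCompletionL N.norm_toCompletion).isUniformInducing

/-- The extension to the completion of a linear map bounded by the seminorm. -/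
def extend {F : Type*} [NormedAddCommGroup F] [NormedSpace ℂ F] [CompleteSpace F]
    (f : P →ₗ[ℂ] F) (hf : ∀ x, ‖f x‖ ≤ N x) : N.Completion →L[ℂ] F :=
  (LinearMap.mkContinuous (E := N.Carrier) f 1 fun x => by
    rw [one_mul]; exact hf x).extend N.toCompletionL

theorem extend_toCompletion {F : Type*} [NormedAddCommGroup F] [NormedSpace ℂ F] [CompleteSpace F]
    (f : P →ₗ[ℂ] F) (hf : ∀ x, ‖f x‖ ≤ N x) (x : P) :
    N.extend f hf (N.toCompletion x) = f x :=
  ContinuousLinearMap.extend_eq (E := N.Carrier) _ N.denseRange_toCompletion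
    N.isUniformInducing_toCompletionL x

/-- The continuous linear extension of a *-homomorphism bounded by the seminorm. -/
def extendHom {C : Type*} [CStarAlgebra C] (h : P →⋆ₐ[ℂ] C) (hN : ∀ x, ‖h x‖ ≤ N x) :
    N.Completion →L[ℂ] C :=
  N.extend h.toAlgHom.toLinearMap fun x => show ‖h x‖ ≤ N x from hN x

theorem extendHom_toCompletion {C : Type*} [CStarAlgebra C] (h : P →⋆ₐ[ℂ] C)
    (hN : ∀ x, ‖h x‖ ≤ N x) (x : P) : N.extendHom h hN (N.toCompletion x) = h x :=
  N.extend_toCompletion _ _ x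

/-- The extension to the completion of a *-homomorphism bounded by the seminorm. -/
def liftHom {C : Type*} [CStarAlgebra C] (h : P →⋆ₐ[ℂ] C) (hN : ∀ x, ‖h x‖ ≤ N x) :
    N.Completion →⋆ₐ[ℂ] C where
  toFun := N.extendHom h hN
  map_one' := by
    rw [← N.toCompletion_one, extendHom_toCompletion, map_one]
  map_mul' x y := by
    refine N.induction (p := fun x => N.extendHom h hN (x * y) =
      N.extendHom h hN x * N.extendHom h hN y) x
      (isClosed_eq (by fun_prop) (by fun_prop)) fun a => ?_
    refine N.induction (p := fun y => N.extendHom h hN (N.toCompletion a * y) =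
      N.extendHom h hN (N.toCompletion a) * N.extendHom h hN y) y
      (isClosed_eq (by fun_prop) (by fun_prop)) fun b => ?_
    rw [← toCompletion_mul, extendHom_toCompletion, extendHom_toCompletion,
      extendHom_toCompletion, map_mul]
  map_zero' := map_zero _
  map_add' := map_add _
  commutes' c := by
    rw [Algebra.algebraMap_eq_smul_one, map_smul, ← N.toCompletion_one, extendHom_toCompletion,
      Algebra.algebraMap_eq_smul_one, map_one]
  map_star' x := by
    have hs := N.continuous_star
    refine N.induction (p := fun x => N.extendHom h hN (star x) = star (N.extendHom h hN x)) x
      (isClosed_eq ((N.extendHom h hN).continuous.comp hs) (by fun_prop)) fun a => ?_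
    rw [star_toCompletion, extendHom_toCompletion, extendHom_toCompletion, StarHomClass.map_star h]

theorem liftHom_toCompletion {C : Type*} [CStarAlgebra C] (h : P →⋆ₐ[ℂ] C)
    (hN : ∀ x, ‖h x‖ ≤ N x) (x : P) : N.liftHom h hN (N.toCompletion x) = h x :=
  N.extendHom_toCompletion h hN x

/-- The extension to the completion of a state bounded by the seminorm. -/
def liftState [StarModule ℂ P] (f : P →ₗ[ℂ] ℂ) (hpos : ∀ x, 0 ≤ f (star x * x)) (hone : f 1 = 1)
    (hN : ∀ x, ‖f x‖ ≤ N x) : CState N.Completion where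
  toFun := N.extend f hN
  nonneg x := by
    have hs := N.continuous_star
    have hc : Continuous fun x : N.Completion => N.extend f hN (star x * x) :=
      (N.extend f hN).continuous.comp (hs.mul continuous_id)
    refine N.induction (p := fun x => 0 ≤ N.extend f hN (star x * x)) x
      (isClosed_le continuous_const hc) fun a => ?_
    rw [star_toCompletion, ← toCompletion_mul, extend_toCompletion]
    exact hpos a
  map_one := by
    rw [← N.toCompletion_one]
    exact (N.extend_toCompletion f hN 1).trans hone

theorem liftState_toCompletion [StarModule ℂ P] (f : P →ₗ[ℂ] ℂ) (hpos : ∀ x, 0 ≤ f (star x * x))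
    (hone : f 1 = 1) (hN : ∀ x, ‖f x‖ ≤ N x) (x : P) :
    N.liftState f hpos hone hN (N.toCompletion x) = f x :=
  N.extend_toCompletion f hN x

end CStarSeminorm

/-! ## The C*-seminorm of a positive functional -/

section GNS

variable {P : Type*} [Ring P] [StarRing P] [Algebra ℂ P]

/-- The *-algebra `P` with the semi-inner product `⟪x, y⟫ = f (x* y)`. -/
def PreHilbert (f : P →ₗ[ℂ] ℂ) (_hf : ∀ x, 0 ≤ f (star x * x)) : Type _ := P

/-- An element of `P` as a vector. -/
def toVec {f : P →ₗ[ℂ] ℂ} (hf : ∀ x, 0 ≤ f (star x * x)) (x : P) : PreHilbert f hf := x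

/-- `PreHilbert` is a type synonym of `P`; this passes from vectors to algebra elements, where
`inner_toVec` and the product of `P` are available. -/
theorem forall_preHilbert {f : P →ₗ[ℂ] ℂ} (hf : ∀ x, 0 ≤ f (star x * x))
    {p : PreHilbert f hf → Prop} (h : ∀ x : P, p (toVec hf x))
    (x : PreHilbert f hf) : p x := h x

variable [StarModule ℂ P]

/-- Polarization: the values of `f` at `y* y` are real for `y = 1`, `x`, `1 + x` and `1 + i x`. The
third gives the imaginary part of the identity, the fourth the real part. -/
theorem map_star_of_nonneg {f : P →ₗ[ℂ] ℂ} (hf : ∀ x, 0 ≤ f (star x * x)) (x : P) :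
    f (star x) = star (f x) := by
  have h0 := (Complex.nonneg_iff.1 (hf 1)).2
  have hx := (Complex.nonneg_iff.1 (hf x)).2
  have h1 := (Complex.nonneg_iff.1 (hf (1 + x))).2
  have h2 := (Complex.nonneg_iff.1 (hf (1 + Complex.I • x))).2
  simp only [star_add, star_one, star_smul, mul_add, add_mul, one_mul, mul_one, map_add, map_smul,
    smul_mul_assoc, mul_smul_comm, Complex.add_im, smul_eq_mul, Complex.mul_im, Complex.mul_re,
    Complex.I_re, Complex.I_im, RCLike.star_def, Complex.conj_I, Complex.neg_re,
    Complex.neg_im] at h0 hx h1 h2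
  apply Complex.ext
  · rw [RCLike.star_def, Complex.conj_re]; linarith
  · rw [RCLike.star_def, Complex.conj_im]; linarith

/-- The semi-inner product `⟪x, y⟫ = f (x* y)` of a positive functional. -/
abbrev gnsCore {f : P →ₗ[ℂ] ℂ} (hf : ∀ x, 0 ≤ f (star x * x)) : PreInnerProductSpace.Core ℂ P where
  inner x y := f (star x * y)
  conj_inner_symm x y := by
    rw [← RCLike.star_def, ← map_star_of_nonneg hf, star_mul, star_star]
  re_inner_nonneg x := (Complex.nonneg_iff.1 (hf x)).1
  add_left x y z := by rw [star_add, add_mul, map_add]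
  smul_left x y c := by rw [star_smul, smul_mul_assoc, map_smul, smul_eq_mul, RCLike.star_def]

variable {f : P →ₗ[ℂ] ℂ} (hf : ∀ x, 0 ≤ f (star x * x))

instance : SeminormedAddCommGroup (PreHilbert f hf) :=
  @InnerProductSpace.Core.toSeminormedAddCommGroup ℂ P _ _ _ (gnsCore hf)
instance : InnerProductSpace ℂ (PreHilbert f hf) :=
  InnerProductSpace.ofCore (F := P) (gnsCore hf)

theorem inner_toVec (x y : P) : inner ℂ (toVec hf x) (toVec hf y) = f (star x * y) := rfl

theorem norm_toVec_sq (x : P) : ‖toVec hf x‖ ^ 2 = (f (star x * x)).re :=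
  norm_sq_eq_re_inner (𝕜 := ℂ) (toVec hf x)

/-- Left multiplication on the pre-Hilbert space of a positive functional. -/
def preHilbertMul (x : P) : PreHilbert f hf →ₗ[ℂ] PreHilbert f hf where
  toFun := fun y : P => toVec hf (x * y)
  map_add' := fun y z : P => mul_add x y z
  map_smul' := fun (c : ℂ) (y : P) => mul_smul_comm c x y

theorem preHilbertMul_toVec (x y : P) : preHilbertMul hf x (toVec hf y) = toVec hf (x * y) := rfl

theorem preHilbert_norm_mul_le {x : P} {c : ℝ} (hc : 0 ≤ c)
    (h : ∀ y, (f (star (x * y) * (x * y))).re ≤ c ^ 2 * (f (star y * y)).re)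
    (y : PreHilbert f hf) : ‖preHilbertMul hf x y‖ ≤ c * ‖y‖ := by
  refine forall_preHilbert hf (p := fun y => ‖preHilbertMul hf x y‖ ≤ c * ‖y‖) (fun y => ?_) y
  refine le_of_sq_le_sq ?_ (by positivity)
  rw [mul_pow, preHilbertMul_toVec, norm_toVec_sq, norm_toVec_sq]
  exact h y

/-- Left multiplications are bounded with respect to the semi-inner product of `f`. -/
def LeftBounded (f : P →ₗ[ℂ] ℂ) : Prop :=
  ∀ x, ∃ c : ℝ, 0 ≤ c ∧ ∀ y, (f (star (x * y) * (x * y))).re ≤ c ^ 2 * (f (star y * y)).re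

variable (hb : LeftBounded f)

/-- The representation of `P` on the pre-Hilbert space of a positive functional. -/
def preHilbertRep (x : P) : PreHilbert f hf →L[ℂ] PreHilbert f hf :=
  LinearMap.mkContinuousOfExistsBound (preHilbertMul hf x) <| by
    obtain ⟨c, hc, h⟩ := hb x
    exact ⟨c, preHilbert_norm_mul_le hf hc h⟩

theorem preHilbertRep_toVec (x y : P) :
    preHilbertRep hf hb x (toVec hf y) = toVec hf (x * y) := rfl

theorem preHilbertRep_mul (x y : P) :
    preHilbertRep hf hb (x * y) = (preHilbertRep hf hb x).comp (preHilbertRep hf hb y) :=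
  ContinuousLinearMap.ext (forall_preHilbert hf fun z => congrArg (toVec hf) (mul_assoc x y z))

/-- Cauchy–Schwarz applied to `‖x y‖² = ⟪y, x* x y⟫`. The space is not complete, so the
C*-inequality is proved by hand instead of through adjoints of bounded operators. -/
theorem norm_preHilbertRep_sq_le (x : P) :
    ‖preHilbertRep hf hb x‖ * ‖preHilbertRep hf hb x‖ ≤ ‖preHilbertRep hf hb (star x * x)‖ := by
  have h0 := norm_nonneg (preHilbertRep hf hb (star x * x))
  rw [← Real.mul_self_sqrt h0]
  refine mul_self_le_mul_self (norm_nonneg _)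
    (ContinuousLinearMap.opNorm_le_bound _ (Real.sqrt_nonneg _) (forall_preHilbert hf fun y => ?_))
  refine le_of_sq_le_sq ?_ (by positivity)
  have hxy : ((‖preHilbertRep hf hb x (toVec hf y)‖ ^ 2 : ℝ) : ℂ).re =
      (inner ℂ (toVec hf y) (preHilbertRep hf hb (star x * x) (toVec hf y)) : ℂ).re := by
    rw [Complex.ofReal_re, preHilbertRep_toVec, preHilbertRep_toVec, norm_toVec_sq, inner_toVec,
      star_mul, mul_assoc, mul_assoc]
  rw [mul_pow, Real.sq_sqrt h0]
  refine hxy.trans_le ((Complex.re_le_norm _).trans ((norm_inner_le_norm _ _).trans ?_))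
  rw [sq, mul_left_comm]
  exact mul_le_mul_of_nonneg_left ((preHilbertRep hf hb (star x * x)).le_opNorm _) (norm_nonneg _)

/-- The C*-seminorm of a positive functional: the operator norm in its GNS representation. -/
def gnsSeminorm : CStarSeminorm P where
  toFun x := ‖preHilbertRep hf hb x‖
  map_zero' := by
    have : preHilbertRep hf hb 0 = 0 :=
      ContinuousLinearMap.ext (forall_preHilbert hf fun z => congrArg (toVec hf) (zero_mul z))
    rw [this, norm_zero]
  add_le' x y := by
    have : preHilbertRep hf hb (x + y) = preHilbertRep hf hb x + preHilbertRep hf hb y :=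
      ContinuousLinearMap.ext (forall_preHilbert hf fun z => congrArg (toVec hf) (add_mul x y z))
    rw [this]; exact norm_add_le _ _
  neg' x := by
    have : preHilbertRep hf hb (-x) = -preHilbertRep hf hb x :=
      ContinuousLinearMap.ext (forall_preHilbert hf fun z => congrArg (toVec hf) (neg_mul x z))
    rw [this, norm_neg]
  smul' c x := by
    have : preHilbertRep hf hb (c • x) = c • preHilbertRep hf hb x :=
      ContinuousLinearMap.ext (forall_preHilbert hf fun z => congrArg (toVec hf) (smul_mul_assoc c x z))
    rw [this, norm_smul]
  mul_le' x y := by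
    rw [preHilbertRep_mul]; exact ContinuousLinearMap.opNorm_comp_le _ _
  star_mul_self' x := by
    -- Dividing the C*-inequality by the norm of `x` shows that the involution does not decrease the
    -- norm; this turns the inequality into the C*-identity.
    have hle : ∀ x, ‖preHilbertRep hf hb x‖ ≤ ‖preHilbertRep hf hb (star x)‖ := fun x => by
      rcases (norm_nonneg (preHilbertRep hf hb x)).eq_or_lt with h | h
      · rw [← h]; exact norm_nonneg _
      · refine le_of_mul_le_mul_right ((norm_preHilbertRep_sq_le hf hb x).trans ?_) h
        rw [preHilbertRep_mul]; exact ContinuousLinearMap.opNorm_comp_le _ _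
    refine le_antisymm ?_ (norm_preHilbertRep_sq_le hf hb x)
    rw [preHilbertRep_mul]
    refine (ContinuousLinearMap.opNorm_comp_le _ _).trans
      (mul_le_mul_of_nonneg_right ?_ (norm_nonneg _))
    simpa using hle (star x)

theorem gnsSeminorm_le {x : P} {c : ℝ} (hc : 0 ≤ c)
    (h : ∀ y, (f (star (x * y) * (x * y))).re ≤ c ^ 2 * (f (star y * y)).re) :
    gnsSeminorm hf hb x ≤ c :=
  ContinuousLinearMap.opNorm_le_bound _ hc (preHilbert_norm_mul_le hf hc h)

/-- `f x` is the matrix coefficient of `x` at the cyclic vector `1`, which is a unit vector because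
`f 1 = 1`. -/
theorem norm_le_gnsSeminorm (h1 : f 1 = 1) (x : P) : ‖f x‖ ≤ gnsSeminorm hf hb x := by
  have he : ‖toVec hf 1‖ = 1 := by
    have : ‖toVec hf 1‖ ^ 2 = 1 := by
      rw [norm_toVec_sq, star_one, one_mul, h1, Complex.one_re]
    exact (pow_eq_one_iff_of_nonneg (norm_nonneg _) two_ne_zero).1 this
  have hx : f x = inner ℂ (toVec hf 1) (preHilbertRep hf hb x (toVec hf 1)) := by
    rw [preHilbertRep_toVec, inner_toVec, star_one, one_mul, mul_one]
  rw [hx]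
  refine (norm_inner_le_norm _ _).trans ?_
  rw [he, one_mul]
  exact ((preHilbertRep hf hb x).le_opNorm _).trans_eq (by rw [he, mul_one]; rfl)

end GNS

/-! ## Continuity of states -/

section States

variable {A B : Type*} [CStarAlgebra A] [CStarAlgebra B]

/-- The inequality `a* a ≤ ‖a‖²` in the form of an explicit square. It can then be inserted into any
functional known only to be nonnegative on elements `y* y`, also on algebras that are not complete.
-/
theorem exists_norm_sq_sub_eq_star_mul_self (a : A) :
    ∃ c : A, ((‖a‖ ^ 2 : ℝ) : ℂ) • (1 : A) - star a * a = star c * c := by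
  let _ := CStarAlgebra.spectralOrder A
  let _ := CStarAlgebra.spectralOrderedRing A
  have h : star a * a ≤ algebraMap ℝ A (‖a‖ ^ 2) := CStarAlgebra.star_mul_le_algebraMap_norm_sq
  obtain ⟨c, hc⟩ := CStarAlgebra.nonneg_iff_eq_star_mul_self.1 (sub_nonneg.2 h)
  refine ⟨c, hc ▸ ?_⟩
  rw [Algebra.algebraMap_eq_smul_one, Complex.coe_smul]

theorem CState.re_star_mul_le (s : CState A) (x y : A) :
    (s (star (x * y) * (x * y))).re ≤ ‖x‖ ^ 2 * (s (star y * y)).re := by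
  obtain ⟨c, hc⟩ := exists_norm_sq_sub_eq_star_mul_self x
  have h := (Complex.nonneg_iff.1 (s.nonneg (c * y))).1
  have : star (c * y) * (c * y) =
      ((‖x‖ ^ 2 : ℝ) : ℂ) • (star y * y) - star (x * y) * (x * y) := by
    rw [star_mul, mul_assoc, ← mul_assoc (star c), ← hc]
    simp only [sub_mul, mul_sub, smul_mul_assoc, mul_smul_comm, one_mul, star_mul, mul_assoc]
  rw [this, map_sub, map_smul, smul_eq_mul, Complex.sub_re, Complex.re_ofReal_mul] at h
  linarith

theorem CState.leftBounded (s : CState A) : LeftBounded s.toFun := fun x =>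
  ⟨‖x‖, norm_nonneg x, s.re_star_mul_le x⟩

/-- A `CState` is not continuous by definition. Its value is bounded by the GNS operator norm, and
that norm is bounded by `‖x‖`. -/
theorem CState.norm_le (s : CState A) (x : A) : ‖s x‖ ≤ ‖x‖ :=
  (norm_le_gnsSeminorm s.nonneg s.leftBounded s.map_one x).trans
    (gnsSeminorm_le s.nonneg s.leftBounded (norm_nonneg x) (s.re_star_mul_le x))

theorem CState.continuous (s : CState A) : Continuous s :=
  (s.toFun.mkContinuous 1 fun x => by rw [one_mul]; exact s.norm_le x).continuous

/-- The pullback of a state along a unital *-homomorphism. -/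
def CState.comap (s : CState B) (h : A →⋆ₐ[ℂ] B) : CState A where
  toFun := s.toFun ∘ₗ h.toAlgHom.toLinearMap
  nonneg a := by
    change 0 ≤ s (h (star a * a))
    rw [map_mul, StarHomClass.map_star h]; exact s.nonneg _
  map_one := by
    change s (h 1) = 1
    rw [_root_.map_one]; exact s.map_one

theorem CState.comap_apply (s : CState B) (h : A →⋆ₐ[ℂ] B) (a : A) : s.comap h a = s (h a) := rfl

end States

theorem continuous_starAlgHom {A B : Type*} [CStarAlgebra A] [CStarAlgebra B] (h : A →⋆ₐ[ℂ] B) :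
    Continuous h :=
  AddMonoidHomClass.continuous_of_bound h 1 fun x => by
    rw [one_mul]; exact NonUnitalStarAlgHom.norm_apply_le h x

/-! ## The universal property of the maximal tensor product -/

namespace MaxTensor

variable {A B C : Type*} [CStarAlgebra A] [CStarAlgebra B] [CStarAlgebra C]

theorem induction {p : MaxTensor A B → Prop} (x : MaxTensor A B) (hc : IsClosed {x | p x})
    (htmul : ∀ a b, p (tmul a b)) (hadd : ∀ x y, p x → p y → p (x + y)) : p x := by
  refine (maxSeminorm A B).induction (p := p) x hc fun a => ?_
  induction a using TensorProduct.induction_on with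
  | zero =>
    have h := htmul 0 0
    unfold tmul at h
    rwa [TensorProduct.zero_tmul] at h
  | tmul a b => exact htmul a b
  | add x y hx hy => rw [CStarSeminorm.toCompletion_add]; exact hadd _ _ hx hy

theorem tmul_add (a : A) (b b' : B) : tmul a (b + b') = tmul a b + tmul a b' := by
  unfold tmul
  rw [TensorProduct.tmul_add]; exact CStarSeminorm.toCompletion_add _ _ _

theorem add_tmul (a a' : A) (b : B) : tmul (a + a') b = tmul a b + tmul a' b := by
  unfold tmul
  rw [TensorProduct.add_tmul]; exact CStarSeminorm.toCompletion_add _ _ _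

theorem tmul_smul (c : ℂ) (a : A) (b : B) : tmul a (c • b) = c • tmul a b := by
  unfold tmul
  rw [TensorProduct.tmul_smul]; exact CStarSeminorm.toCompletion_smul _ _ _

theorem smul_tmul (c : ℂ) (a : A) (b : B) : tmul (c • a) b = c • tmul a b := by
  unfold tmul
  rw [← TensorProduct.smul_tmul']; exact CStarSeminorm.toCompletion_smul _ _ _

variable (A B) in
/-- The embedding `a ↦ a ⊗ 1`. -/
def inl : A →⋆ₐ[ℂ] MaxTensor A B where
  toFun a := tmul a 1
  map_one' := tmul_one_one
  map_mul' a a' := by rw [tmul_mul, one_mul]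
  map_zero' := by simpa using smul_tmul (0 : ℂ) (0 : A) (1 : B)
  map_add' a a' := add_tmul a a' 1
  commutes' c := by
    rw [Algebra.algebraMap_eq_smul_one, smul_tmul, tmul_one_one, Algebra.algebraMap_eq_smul_one]
  map_star' a := by rw [star_tmul, star_one]

variable (A B) in
/-- The embedding `b ↦ 1 ⊗ b`. -/
def inr : B →⋆ₐ[ℂ] MaxTensor A B where
  toFun b := tmul 1 b
  map_one' := tmul_one_one
  map_mul' b b' := by rw [tmul_mul, one_mul]
  map_zero' := by simpa using tmul_smul (0 : ℂ) (1 : A) (0 : B)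
  map_add' b b' := tmul_add 1 b b'
  commutes' c := by
    rw [Algebra.algebraMap_eq_smul_one, tmul_smul, tmul_one_one, Algebra.algebraMap_eq_smul_one]
  map_star' b := by rw [star_tmul, star_one]

theorem inl_apply (a : A) : inl A B a = tmul a 1 := rfl

theorem inr_apply (b : B) : inr A B b = tmul 1 b := rfl

theorem inl_mul_inr (a : A) (b : B) : inl A B a * inr A B b = tmul a b := by
  rw [inl_apply, inr_apply, tmul_mul, mul_one, one_mul]

theorem commute_inl_inr (a : A) (b : B) : Commute (inl A B a) (inr A B b) := by
  rw [Commute, SemiconjBy, inl_mul_inr, inl_apply, inr_apply, tmul_mul, mul_one, one_mul]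

theorem continuous_tmul_left (b : B) : Continuous fun a : A => tmul a b := by
  simp only [← inl_mul_inr]
  exact (continuous_starAlgHom _).mul continuous_const

theorem continuous_tmul_right (a : A) : Continuous fun b : B => tmul a b := by
  simp only [← inl_mul_inr]
  exact continuous_const.mul (continuous_starAlgHom _)

/-- The *-homomorphism `a ⊗ b ↦ f a * g b` for commuting `f` and `g`. -/
def lift (f : A →⋆ₐ[ℂ] C) (g : B →⋆ₐ[ℂ] C) (hfg : ∀ a b, Commute (f a) (g b)) :
    MaxTensor A B →⋆ₐ[ℂ] C :=
  let h : A ⊗[ℂ] B →⋆ₐ[ℂ] C :=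
    { Algebra.TensorProduct.lift f.toAlgHom g.toAlgHom hfg with
      map_star' := fun x => by
        change Algebra.TensorProduct.lift f.toAlgHom g.toAlgHom hfg (star x) =
          star (Algebra.TensorProduct.lift f.toAlgHom g.toAlgHom hfg x)
        induction x using TensorProduct.induction_on with
        | zero => simp
        | tmul a b =>
          rw [TensorProduct.star_tmul, Algebra.TensorProduct.lift_tmul,
            Algebra.TensorProduct.lift_tmul]
          change f (star a) * g (star b) = star (f a * g b)
          rw [(hfg a b).eq, star_mul, StarHomClass.map_star f, StarHomClass.map_star g]
        | add x y hx hy => rw [star_add, map_add, map_add, star_add, hx, hy] }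
  (maxSeminorm A B).liftHom h fun x =>
    -- The seminorm `‖h x‖` takes part in the supremum that defines the maximal norm, and is
    -- therefore below it.
    CStarSeminorm.le_sup (M := CStarSeminorm.ofStarAlgHom h) (fun a b => by
      have : h (a ⊗ₜ[ℂ] b) = f a * g b := Algebra.TensorProduct.lift_tmul _ _ hfg a b
      rw [CStarSeminorm.ofStarAlgHom_apply, this]
      exact (norm_mul_le _ _).trans (mul_le_mul (NonUnitalStarAlgHom.norm_apply_le f a)
        (NonUnitalStarAlgHom.norm_apply_le g b) (norm_nonneg _) (norm_nonneg _))) x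

theorem lift_tmul (f : A →⋆ₐ[ℂ] C) (g : B →⋆ₐ[ℂ] C) (hfg : ∀ a b, Commute (f a) (g b))
    (a : A) (b : B) : lift f g hfg (tmul a b) = f a * g b :=
  (CStarSeminorm.liftHom_toCompletion _ _ _ _).trans (Algebra.TensorProduct.lift_tmul _ _ hfg a b)

theorem hom_ext {f g : MaxTensor A B →⋆ₐ[ℂ] C} (hl : ∀ a, f (tmul a 1) = g (tmul a 1))
    (hr : ∀ b, f (tmul 1 b) = g (tmul 1 b)) : f = g := by
  refine StarAlgHom.ext fun x => ?_
  refine induction (p := fun x => f x = g x) x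
    (isClosed_eq (continuous_starAlgHom f) (continuous_starAlgHom g)) (fun a b => ?_)
    fun x y hx hy => by rw [map_add, map_add, hx, hy]
  rw [← inl_mul_inr, map_mul, map_mul, inl_apply, inr_apply, hl, hr]

theorem commute_of_forall (h : MaxTensor A B →⋆ₐ[ℂ] C) (y : C)
    (hl : ∀ a, Commute (h (tmul a 1)) y) (hr : ∀ b, Commute (h (tmul 1 b)) y)
    (x : MaxTensor A B) : Commute (h x) y := by
  have hc := continuous_starAlgHom h
  refine induction (p := fun x => h x * y = y * h x) x
    (isClosed_eq (hc.mul continuous_const) (continuous_const.mul hc)) (fun a b => ?_)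
    fun x z hx hz => by rw [map_add, add_mul, mul_add, hx, hz]
  rw [← inl_mul_inr, map_mul]
  exact (hl a).mul_left (hr b)

variable {D : Type*} [CStarAlgebra D]

/-- The tensor product `f ⊗ g` of two *-homomorphisms. -/
def map (f : A →⋆ₐ[ℂ] C) (g : B →⋆ₐ[ℂ] D) : MaxTensor A B →⋆ₐ[ℂ] MaxTensor C D :=
  lift ((inl C D).comp f) ((inr C D).comp g) fun a b => commute_inl_inr (f a) (g b)

theorem map_tmul (f : A →⋆ₐ[ℂ] C) (g : B →⋆ₐ[ℂ] D) (a : A) (b : B) :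
    map f g (tmul a b) = tmul (f a) (g b) :=
  (lift_tmul _ _ _ a b).trans (inl_mul_inr _ _)

/-- The tensor product `f ⊗ g` of two *-isomorphisms. -/
def congr (f : A ≃⋆ₐ[ℂ] C) (g : B ≃⋆ₐ[ℂ] D) : MaxTensor A B ≃⋆ₐ[ℂ] MaxTensor C D :=
  StarAlgEquiv.ofStarAlgHom (map f g) (map f.symm g.symm)
    (hom_ext (fun a => by simp [map_tmul]) fun b => by simp [map_tmul])
    (hom_ext (fun a => by simp [map_tmul]) fun b => by simp [map_tmul])

theorem congr_tmul (f : A ≃⋆ₐ[ℂ] C) (g : B ≃⋆ₐ[ℂ] D) (a : A) (b : B) :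
    congr f g (tmul a b) = tmul (f a) (g b) :=
  map_tmul _ _ a b

end MaxTensor

/-! ## Finitely supported families -/

namespace FinSupp

variable {ι : Type*} {A : ι → Type*} [∀ i, CStarAlgebra (A i)]

theorem update_apply_self (a : FinSupp A) (i : ι) (x : A i) : (update a i x).1 i = x := by
  classical
  exact Function.update_self i x a.1

theorem update_apply_of_ne (a : FinSupp A) {i j : ι} (h : j ≠ i) (x : A i) :
    (update a i x).1 j = a.1 j := by
  classical
  exact Function.update_of_ne h x a.1

theorem ext_of_ne {a b : FinSupp A} (i : ι) (hi : a.1 i = b.1 i) (h : ∀ j ≠ i, a.1 j = b.1 j) :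
    a = b := by
  refine Subtype.ext (funext fun j => ?_)
  by_cases hj : j = i
  · subst hj; exact hi
  · exact h j hj

theorem mul_apply (a b : FinSupp A) (i : ι) : (a * b).1 i = a.1 i * b.1 i := rfl

theorem one_apply (i : ι) : (1 : FinSupp A).1 i = 1 := rfl

theorem star_apply (a : FinSupp A) (i : ι) : (star a).1 i = star (a.1 i) := rfl

theorem update_update (a : FinSupp A) (i : ι) (x y : A i) :
    update (update a i x) i y = update a i y :=
  ext_of_ne i (by rw [update_apply_self, update_apply_self]) fun j hj => by
    rw [update_apply_of_ne _ hj, update_apply_of_ne _ hj, update_apply_of_ne _ hj]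

theorem update_eq_self (a : FinSupp A) (i : ι) : update a i (a.1 i) = a :=
  ext_of_ne i (update_apply_self _ _ _) fun _ hj => update_apply_of_ne _ hj _

theorem update_mul_update (a b : FinSupp A) (i : ι) (x y : A i) :
    update a i x * update b i y = update (a * b) i (x * y) :=
  ext_of_ne i (by rw [mul_apply, update_apply_self, update_apply_self, update_apply_self])
    fun j hj => by
      rw [mul_apply, update_apply_of_ne _ hj, update_apply_of_ne _ hj, update_apply_of_ne _ hj,
        mul_apply]

theorem star_update (a : FinSupp A) (i : ι) (x : A i) :
    star (update a i x) = update (star a) i (star x) :=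
  ext_of_ne i (by rw [star_apply, update_apply_self, update_apply_self]) fun j hj => by
    rw [star_apply, update_apply_of_ne _ hj, update_apply_of_ne _ hj, star_apply]

theorem update_one_one (i : ι) : update (1 : FinSupp A) i 1 = 1 := update_eq_self 1 i

theorem update_eq_mul (a : FinSupp A) (i : ι) (x : A i) :
    update a i x = update a i 1 * update 1 i x := by
  rw [update_mul_update, mul_one, one_mul]

theorem eq_one_of_notMem_support (a : FinSupp A) {i : ι} (hi : i ∉ a.2.toFinset) : a.1 i = 1 := by
  by_contra h
  exact hi ((Set.Finite.mem_toFinset _).2 h)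

/-- Entries are filled in one at a time. The hypothesis that the entry was `1` before makes each
update a multiplication by an embedded element; see `tprod_update_of_eq_one`. -/
theorem induction {p : FinSupp A → Prop} (a : FinSupp A) (one : p 1)
    (update : ∀ (a : FinSupp A) (i : ι) (x : A i), a.1 i = 1 → p a → p (update a i x)) : p a := by
  classical
  suffices ∀ (s : Finset ι) (a : FinSupp A), (∀ i ∉ s, a.1 i = 1) → p a from
    this a.2.toFinset a fun i hi => eq_one_of_notMem_support a hi
  intro s
  induction s using Finset.induction_on with
  | empty =>
    intro a ha
    have : a = 1 := Subtype.ext (funext fun i => ha i (Finset.notMem_empty i))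
    rwa [this]
  | insert i s hi ih =>
    intro a ha
    rw [← update_eq_self a i, ← update_update a i 1]
    refine update _ _ _ (update_apply_self _ _ _) (ih _ fun j hj => ?_)
    by_cases h : j = i
    · subst h; exact update_apply_self _ _ _
    · rw [update_apply_of_ne _ h]
      exact ha j fun hj' => (Finset.mem_insert.1 hj').elim h hj

end FinSupp

/-! ## The universal property of the finitely supported tensor product -/

section Lift

variable {ι : Type*} {A : ι → Type*} [∀ i, CStarAlgebra (A i)]

/-- All three conditions pass to the supremum. Hence the multilinearity relations, imposed on each
seminorm separately, hold in the completion. -/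
theorem finTensorSeminorm_mem : finTensorSeminorm A ∈ finTensorSeminorms A := by
  have h0 : ∀ x : FormalTensor A, (∀ N ∈ finTensorSeminorms A, N x = 0) →
      finTensorSeminorm A x = 0 := fun x hx => by
    have := (finTensorSeminorms_nonempty A).to_subtype
    refine le_antisymm (ciSup_le fun N => (hx N.1 N.2).le) ((finTensorSeminorm A).nonneg x)
  refine ⟨fun a i x y => h0 _ fun N hN => hN.1 a i x y,
    fun a i c x => h0 _ fun N hN => hN.2.1 a i c x, fun a => ?_⟩
  have := (finTensorSeminorms_nonempty A).to_subtype
  exact ciSup_le fun N => N.2.2.2 a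

theorem toCompletion_sub {P : Type*} [Ring P] [StarRing P] [Algebra ℂ P] (N : CStarSeminorm P)
    (x y : P) : N.toCompletion (x - y) = N.toCompletion x - N.toCompletion y :=
  map_sub N.toCompletionL x y

theorem tprod_mul (a b : FinSupp A) : tprod (a * b) = tprod a * tprod b := by
  unfold tprod
  rw [formal_mul]; exact CStarSeminorm.toCompletion_mul _ _ _

theorem tprod_one : tprod (1 : FinSupp A) = 1 := rfl

theorem star_tprod (a : FinSupp A) : star (tprod a) = tprod (star a) :=
  ((finTensorSeminorm A).star_toCompletion _).trans
    (congrArg (finTensorSeminorm A).toCompletion (star_formal a))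

theorem tprod_update_add (a : FinSupp A) (i : ι) (x y : A i) :
    tprod (FinSupp.update a i (x + y)) =
      tprod (FinSupp.update a i x) + tprod (FinSupp.update a i y) := by
  have h := finTensorSeminorm_mem.1 a i x y
  rw [← CStarSeminorm.norm_toCompletion, norm_eq_zero, toCompletion_sub, toCompletion_sub,
    sub_sub, sub_eq_zero] at h
  exact h

theorem tprod_update_smul (a : FinSupp A) (i : ι) (c : ℂ) (x : A i) :
    tprod (FinSupp.update a i (c • x)) = c • tprod (FinSupp.update a i x) := by
  have h := finTensorSeminorm_mem.2.1 a i c x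
  rw [← CStarSeminorm.norm_toCompletion, norm_eq_zero, toCompletion_sub, sub_eq_zero,
    CStarSeminorm.toCompletion_smul] at h
  exact h

/-- The embedding of the `i`-th factor as a *-homomorphism. -/
def embedHom (i : ι) : A i →⋆ₐ[ℂ] FinTensor A where
  toFun := embed i
  map_one' := congrArg tprod (FinSupp.update_one_one i)
  map_mul' x y := by
    unfold embed
    rw [← tprod_mul, FinSupp.update_mul_update, mul_one]
  map_zero' := by simpa [embed] using tprod_update_smul (1 : FinSupp A) i 0 0
  map_add' x y := tprod_update_add 1 i x y
  commutes' c := by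
    rw [Algebra.algebraMap_eq_smul_one, Algebra.algebraMap_eq_smul_one]
    refine (tprod_update_smul 1 i c 1).trans ?_
    rw [FinSupp.update_one_one, tprod_one]
  map_star' x := by
    unfold embed
    rw [star_tprod, FinSupp.star_update, star_one]

theorem embedHom_apply (i : ι) (x : A i) : embedHom i x = embed i x := rfl

theorem tprod_update (a : FinSupp A) (i : ι) (x : A i) :
    tprod (FinSupp.update a i x) = tprod (FinSupp.update a i 1) * embed i x := by
  rw [FinSupp.update_eq_mul, tprod_mul]; rfl

theorem tprod_update_of_eq_one {a : FinSupp A} {i : ι} (ha : a.1 i = 1) (x : A i) :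
    tprod (FinSupp.update a i x) = tprod a * embed i x := by
  rw [tprod_update, ← ha, FinSupp.update_eq_self]

theorem commute_embed {i j : ι} (h : i ≠ j) (x : A i) (y : A j) :
    Commute (embed (A := A) i x) (embed j y) := by
  rw [Commute, SemiconjBy]
  unfold embed
  rw [← tprod_mul, ← tprod_mul]
  refine congrArg tprod (Subtype.ext (funext fun k => ?_))
  rw [FinSupp.mul_apply, FinSupp.mul_apply]
  by_cases hk : k = i
  · subst hk
    rw [FinSupp.update_apply_of_ne _ h, FinSupp.one_apply, mul_one, one_mul]
  · rw [FinSupp.update_apply_of_ne _ hk, FinSupp.one_apply, mul_one, one_mul]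

theorem FinTensor.induction {p : FinTensor A → Prop} (x : FinTensor A) (hc : IsClosed {x | p x})
    (htprod : ∀ a, p (tprod a)) (hadd : ∀ x y, p x → p y → p (x + y))
    (hsmul : ∀ (c : ℂ) x, p x → p (c • x)) : p x := by
  refine (finTensorSeminorm A).induction (p := p) x hc fun a => ?_
  refine formal_induction (p := fun a => p ((finTensorSeminorm A).toCompletion a)) a htprod
    (fun x y hx hy => ?_) fun c x hx => ?_
  · rw [CStarSeminorm.toCompletion_add]; exact hadd _ _ hx hy
  · rw [CStarSeminorm.toCompletion_smul]; exact hsmul _ _ hx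

/-- The factors generate: an elementary tensor is a finite product of embedded elements. This
reduces identities between *-homomorphisms, and commutation, to single factors. -/
theorem FinTensor.induction_embed {p : FinTensor A → Prop} (x : FinTensor A)
    (hc : IsClosed {x | p x}) (hone : p 1) (hembed : ∀ i x, p (embed i x))
    (hmul : ∀ x y, p x → p y → p (x * y)) (hadd : ∀ x y, p x → p y → p (x + y))
    (hsmul : ∀ (c : ℂ) x, p x → p (c • x)) : p x := by
  refine FinTensor.induction x hc (fun a => ?_) hadd hsmul
  refine FinSupp.induction (p := fun a => p (tprod a)) a hone fun a i x ha h => ?_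
  rw [tprod_update_of_eq_one ha]
  exact hmul _ _ h (hembed i x)

variable {C : Type*} [CStarAlgebra C]

theorem FinTensor.hom_ext {f g : FinTensor A →⋆ₐ[ℂ] C} (h : ∀ i x, f (embed i x) = g (embed i x)) :
    f = g := by
  refine StarAlgHom.ext fun x => ?_
  refine FinTensor.induction_embed (p := fun x => f x = g x) x
    (isClosed_eq (continuous_starAlgHom f) (continuous_starAlgHom g)) (by simp) h ?_ ?_ ?_
  · intro x y hx hy; rw [map_mul, map_mul, hx, hy]
  · intro x y hx hy; rw [map_add, map_add, hx, hy]
  · intro c x hx; rw [map_smul, map_smul, hx]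

theorem FinTensor.commute_of_forall (h : FinTensor A →⋆ₐ[ℂ] C) (y : C)
    (hy : ∀ i x, Commute (h (embed i x)) y) (x : FinTensor A) : Commute (h x) y := by
  have hc := continuous_starAlgHom h
  refine FinTensor.induction_embed (p := fun x => Commute (h x) y) x
    (isClosed_eq (hc.mul continuous_const) (continuous_const.mul hc)) ?_ hy ?_ ?_ ?_
  · rw [map_one]; exact Commute.one_left y
  · intro x z hx hz; rw [map_mul]; exact hx.mul_left hz
  · intro x z hx hz; rw [map_add]; exact hx.add_left hz
  · intro c x hx; rw [map_smul]; exact hx.smul_left c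

section NoncommProd

theorem pairwise_commute (φ : ∀ i, A i →⋆ₐ[ℂ] C)
    (hφ : Pairwise fun i j => ∀ x y, Commute (φ i x) (φ j y)) (s : Finset ι) (a : ∀ i, A i) :
    (s : Set ι).Pairwise (Function.onFun Commute fun i => φ i (a i)) :=
  fun _ _ _ _ hij => hφ hij _ _

variable (φ : ∀ i, A i →⋆ₐ[ℂ] C) (hφ : Pairwise fun i j => ∀ x y, Commute (φ i x) (φ j y))

/-- The product of the `φ i (a i)` over a finite set. -/
def prodOver (s : Finset ι) (a : ∀ i, A i) : C :=
  s.noncommProd (fun i => φ i (a i)) (pairwise_commute φ hφ s a)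

theorem prodOver_empty (a : ∀ i, A i) : prodOver φ hφ ∅ a = 1 := Finset.noncommProd_empty _ _

theorem prodOver_cons {s : Finset ι} {i : ι} (hi : i ∉ s) (a : ∀ i, A i) :
    prodOver φ hφ (Finset.cons i s hi) a = φ i (a i) * prodOver φ hφ s a :=
  Finset.noncommProd_cons _ _ _ _ _

theorem prodOver_cons' {s : Finset ι} {i : ι} (hi : i ∉ s) (a : ∀ i, A i) :
    prodOver φ hφ (Finset.cons i s hi) a = prodOver φ hφ s a * φ i (a i) :=
  Finset.noncommProd_cons' _ _ _ _ _

theorem prodOver_subset {s t : Finset ι} (hst : s ⊆ t) {a : ∀ i, A i}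
    (h : ∀ i ∈ t, i ∉ s → a i = 1) : prodOver φ hφ t a = prodOver φ hφ s a := by
  classical
  have h1 : prodOver φ hφ (t \ s) a = 1 := by
    refine (Finset.noncommProd_eq_pow_card (t \ s) _ _ 1 fun i hi => ?_).trans (one_pow _)
    rw [h i (Finset.mem_sdiff.1 hi).1 (Finset.mem_sdiff.1 hi).2, map_one]
  have h2 : prodOver φ hφ (s ∪ t \ s) a = prodOver φ hφ s a * prodOver φ hφ (t \ s) a :=
    Finset.noncommProd_union_of_disjoint Finset.disjoint_sdiff _ _
  rwa [Finset.union_sdiff_of_subset hst, h1, mul_one] at h2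

theorem prodOver_mul (s : Finset ι) (a b : ∀ i, A i) :
    prodOver φ hφ s (a * b) = prodOver φ hφ s a * prodOver φ hφ s b := by
  unfold prodOver
  rw [← Finset.noncommProd_mul_distrib _ _ (pairwise_commute φ hφ s a) (pairwise_commute φ hφ s b)
    fun i _ j _ hij => hφ hij _ _]
  exact Finset.noncommProd_congr rfl (fun i _ => map_mul (φ i) _ _) _

theorem prodOver_star (s : Finset ι) (a : ∀ i, A i) :
    prodOver φ hφ s (star a) = star (prodOver φ hφ s a) := by
  induction s using Finset.cons_induction_on with
  | empty => rw [prodOver_empty, prodOver_empty, star_one]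
  | cons i s hi ih =>
    rw [prodOver_cons', prodOver_cons, star_mul, ih, Pi.star_apply, StarHomClass.map_star (φ i)]

theorem norm_prodOver_le (s : Finset ι) (a : ∀ i, A i) :
    ‖prodOver φ hφ s a‖ ≤ ∏ i ∈ s, ‖a i‖ := by
  -- The zero algebra is treated apart because the empty product is estimated by `‖1‖ = 1`.
  rcases subsingleton_or_nontrivial C with hC | hC
  · rw [Subsingleton.elim (prodOver φ hφ s a) 0, norm_zero]
    exact Finset.prod_nonneg fun i _ => norm_nonneg _
  induction s using Finset.cons_induction_on with
  | empty => rw [prodOver_empty, Finset.prod_empty, CStarRing.norm_one]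
  | cons i s hi ih =>
    rw [prodOver_cons, Finset.prod_cons]
    exact (norm_mul_le _ _).trans (mul_le_mul (NonUnitalStarAlgHom.norm_apply_le (φ i) _) ih
      (norm_nonneg _) (norm_nonneg _))

theorem prodOver_eq [DecidableEq ι] {s : Finset ι} {i : ι} (hi : i ∈ s) (a : ∀ i, A i) :
    prodOver φ hφ s a = φ i (a i) * prodOver φ hφ (s.erase i) a :=
  (Finset.mul_noncommProd_erase _ hi _ _).symm

/-- The supports of `a * b` and `star a` are awkward to compute exactly; any finite set outside
which the entries are `1` gives the same product. -/
theorem prodOver_support_eq (a : FinSupp A) {t : Finset ι} (ht : ∀ i ∉ t, a.1 i = 1) :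
    prodOver φ hφ a.2.toFinset a.1 = prodOver φ hφ t a.1 := by
  classical
  rw [← prodOver_subset φ hφ (Finset.subset_union_left (s₂ := t)),
    prodOver_subset φ hφ (Finset.subset_union_right (s₁ := a.2.toFinset))]
  · exact fun i _ hi => ht i hi
  · exact fun i _ hi => FinSupp.eq_one_of_notMem_support a hi

/-- The multiplicative map `a ↦ ∏ φ i (a i)` on finitely supported families. -/
def finSuppLift : FinSupp A →* C where
  toFun a := prodOver φ hφ a.2.toFinset a.1
  map_one' := by
    rw [prodOver_support_eq φ hφ 1 (t := ∅) fun _ _ => rfl, prodOver_empty]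
  map_mul' a b := by
    classical
    have ha : ∀ i ∉ a.2.toFinset ∪ b.2.toFinset, a.1 i = 1 := fun i hi =>
      FinSupp.eq_one_of_notMem_support a fun h => hi (Finset.mem_union_left _ h)
    have hb : ∀ i ∉ a.2.toFinset ∪ b.2.toFinset, b.1 i = 1 := fun i hi =>
      FinSupp.eq_one_of_notMem_support b fun h => hi (Finset.mem_union_right _ h)
    rw [prodOver_support_eq φ hφ a ha, prodOver_support_eq φ hφ b hb,
      prodOver_support_eq φ hφ (a * b) (t := a.2.toFinset ∪ b.2.toFinset), ← prodOver_mul]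
    · rfl
    · intro i hi
      rw [FinSupp.mul_apply, ha i hi, hb i hi, mul_one]

theorem finSuppLift_star (a : FinSupp A) :
    finSuppLift φ hφ (star a) = star (finSuppLift φ hφ a) := by
  change prodOver φ hφ (star a).2.toFinset (star a).1 = star (prodOver φ hφ a.2.toFinset a.1)
  rw [prodOver_support_eq φ hφ (star a) (t := a.2.toFinset), ← prodOver_star]
  · rfl
  · intro i hi
    rw [FinSupp.star_apply, FinSupp.eq_one_of_notMem_support a hi, star_one]

/-- The second factor does not involve `x`, so linearity in the entry at `i` reduces to linearity of
`φ i`. -/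
theorem finSuppLift_update (a : FinSupp A) (i : ι) (x : A i) :
    finSuppLift φ hφ (FinSupp.update a i x) =
      φ i x * finSuppLift φ hφ (FinSupp.update a i 1) := by
  classical
  have h : ∀ x : A i, finSuppLift φ hφ (FinSupp.update 1 i x) = φ i x := fun x => by
    change prodOver φ hφ _ _ = _
    rw [prodOver_support_eq φ hφ _ (t := {i}), prodOver_eq φ hφ (Finset.mem_singleton_self i),
      FinSupp.update_apply_self, Finset.erase_singleton, prodOver_empty, mul_one]
    intro j hj
    rw [FinSupp.update_apply_of_ne _ (by simpa using hj), FinSupp.one_apply]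
  rw [← h, ← map_mul, FinSupp.update_mul_update, one_mul, mul_one]

theorem finSuppLift_update_one (i : ι) (x : A i) :
    finSuppLift φ hφ (FinSupp.update 1 i x) = φ i x := by
  rw [finSuppLift_update, FinSupp.update_one_one, map_one, mul_one]

/-- The *-homomorphism on formal tensors given by commuting *-homomorphisms on the factors. -/
def formalLift : FormalTensor A →⋆ₐ[ℂ] C :=
  { MonoidAlgebra.lift ℂ C (FinSupp A) (finSuppLift φ hφ) with
    map_star' := fun x => by
      change MonoidAlgebra.lift ℂ C (FinSupp A) (finSuppLift φ hφ) (star x) =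
        star (MonoidAlgebra.lift ℂ C (FinSupp A) (finSuppLift φ hφ) x)
      refine formal_induction (p := fun x =>
        MonoidAlgebra.lift ℂ C (FinSupp A) (finSuppLift φ hφ) (star x) =
          star (MonoidAlgebra.lift ℂ C (FinSupp A) (finSuppLift φ hφ) x)) x (fun a => ?_)
        (fun x y hx hy => ?_) fun c x hx => ?_
      · rw [star_formal]
        unfold formal
        rw [MonoidAlgebra.lift_single, MonoidAlgebra.lift_single, one_smul, one_smul,
          finSuppLift_star]
      · rw [star_add, map_add, map_add, star_add, hx, hy]
      · rw [star_smul, map_smul, map_smul, star_smul, hx] }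

theorem formalLift_formal (a : FinSupp A) :
    formalLift φ hφ (formal a) = finSuppLift φ hφ a :=
  (MonoidAlgebra.lift_single _ _ _).trans (one_smul _ _)

/-- With this the universal property is immediate: the homomorphism on formal tensors is dominated
by the maximal seminorm. -/
theorem formalLift_mem :
    CStarSeminorm.ofStarAlgHom (formalLift φ hφ) ∈ finTensorSeminorms A := by
  refine ⟨fun a i x y => ?_, fun a i c x => ?_, fun a => ?_⟩
  · rw [CStarSeminorm.ofStarAlgHom_apply, map_sub, map_sub, formalLift_formal, formalLift_formal,
      formalLift_formal, finSuppLift_update, finSuppLift_update _ _ a i x,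
      finSuppLift_update _ _ a i y, map_add, add_mul, add_sub_cancel_left, sub_self, norm_zero]
  · rw [CStarSeminorm.ofStarAlgHom_apply, map_sub, map_smul, formalLift_formal, formalLift_formal,
      finSuppLift_update, finSuppLift_update _ _ a i x, map_smul, smul_mul_assoc, sub_self,
      norm_zero]
  · rw [CStarSeminorm.ofStarAlgHom_apply, formalLift_formal]
    exact norm_prodOver_le φ hφ _ _

/-- The *-homomorphism `⨂ aᵢ ↦ ∏ φᵢ aᵢ` for commuting *-homomorphisms `φᵢ`. -/
def FinTensor.lift : FinTensor A →⋆ₐ[ℂ] C :=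
  (finTensorSeminorm A).liftHom (formalLift φ hφ) fun x =>
    CStarSeminorm.le_sup (formalLift_mem φ hφ) x

theorem FinTensor.lift_embed (i : ι) (x : A i) : FinTensor.lift φ hφ (embed i x) = φ i x :=
  (CStarSeminorm.liftHom_toCompletion _ _ _ _).trans
    ((formalLift_formal _ _ _).trans (finSuppLift_update_one φ hφ i x))

end NoncommProd

end Lift

/-! ## Product states -/

section ProductState

variable {ι : Type*} {A : ι → Type*} [∀ i, CStarAlgebra (A i)] (ω : ∀ i, CState (A i))

theorem hasFiniteMulSupport_state (a : FinSupp A) :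
    Function.HasFiniteMulSupport fun i => ω i (a.1 i) :=
  a.2.subset fun i hi h => hi (by
    change ω i (a.1 i) = 1
    rw [h]; exact (ω i).map_one)

/-- The value of a product state on an elementary tensor. -/
def prodValue (a : FinSupp A) : ℂ := ∏ᶠ i, ω i (a.1 i)

theorem prodValue_one : prodValue ω 1 = 1 :=
  finprod_eq_one_of_forall_eq_one fun i => (ω i).map_one

theorem prodValue_update (a : FinSupp A) (i : ι) (x : A i) :
    prodValue ω (FinSupp.update a i x) = ω i x * prodValue ω (FinSupp.update a i 1) := by
  have h : ∀ x : A i, prodValue ω (FinSupp.update a i x) =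
      ω i x * ∏ᶠ (j) (_ : j ≠ i), ω j (a.1 j) := fun x => by
    unfold prodValue
    rw [← mul_finprod_cond_ne i (hasFiniteMulSupport_state ω _), FinSupp.update_apply_self]
    congr 1
    refine finprod_congr fun j => finprod_congr fun hj => ?_
    rw [FinSupp.update_apply_of_ne _ hj]
  rw [h, h 1, (ω i).map_one, one_mul]

/-- The product functional on formal tensors. -/
def prodFunctional : FormalTensor A →ₗ[ℂ] ℂ :=
  Finsupp.linearCombination ℂ (prodValue ω) ∘ₗ (MonoidAlgebra.coeffLinearEquiv ℂ).toLinearMap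

theorem prodFunctional_single (a : FinSupp A) (c : ℂ) :
    prodFunctional ω (MonoidAlgebra.single a c) = c * prodValue ω a :=
  (Finsupp.linearCombination_single ℂ c a)

theorem prodFunctional_formal (a : FinSupp A) : prodFunctional ω (formal a) = prodValue ω a :=
  (prodFunctional_single ω a 1).trans (one_mul _)

theorem CState.map_star {B : Type*} [CStarAlgebra B] (s : CState B) (x : B) :
    s (star x) = star (s x) := map_star_of_nonneg s.nonneg x

/-- A Gram matrix for the semi-inner product of `s`: its quadratic form at `c` is `s (y* y)` with `y
= ∑ cᵢ vᵢ`. -/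
theorem posSemidef_state {I B : Type*} [CStarAlgebra B] (s : CState B) (v : I → B) :
    (Matrix.of fun i j => s (star (v i) * v j)).PosSemidef := by
  refine ⟨Matrix.ext fun i j => ?_, fun x => ?_⟩
  · rw [Matrix.conjTranspose_apply, Matrix.of_apply, Matrix.of_apply, ← s.map_star, star_mul,
      star_star]
  · have := s.nonneg (x.sum fun i c => c • v i)
    simp only [Finsupp.sum, star_sum, star_smul, Finset.sum_mul_sum, map_sum, smul_mul_assoc,
      mul_smul_comm, map_smul, smul_eq_mul] at this
    simp only [Finsupp.sum, Matrix.of_apply]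
    exact this.trans_eq
      (Finset.sum_congr rfl fun i _ => Finset.sum_congr rfl fun j _ => by ring)

/-- The Schur product theorem: the kernel is the entrywise product of the Gram kernels of the single
states. -/
theorem posSemidef_prod (s : Finset ι) :
    (Matrix.of fun a b : FinSupp A => ∏ i ∈ s, ω i (star (a.1 i) * b.1 i)).PosSemidef := by
  induction s using Finset.cons_induction_on with
  | empty =>
    -- The empty product is the kernel with all entries `1`, whose quadratic form is `|∑ c|²`.
    refine ⟨Matrix.ext fun i j => by simp, fun x => ?_⟩
    have := star_mul_self_nonneg (x.sum fun _ c => c)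
    simpa [Finsupp.sum, Finset.sum_mul_sum] using this
  | cons i s hi ih =>
    simp only [Finset.prod_cons]
    exact (posSemidef_state (ω i) fun a : FinSupp A => a.1 i).hadamard ih

/-- Expanding `x* x` over the support of `x` gives the quadratic form of the kernel in
`posSemidef_prod`, evaluated at the coefficients of `x`. -/
theorem prodFunctional_nonneg (x : FormalTensor A) : 0 ≤ prodFunctional ω (star x * x) := by
  classical
  -- One finite set of indices for all tensors occurring in `x`: outside it all entries are `1`, and
  -- the states contribute the factor `1`.
  set s : Finset ι := x.coeff.support.biUnion fun a => a.2.toFinset with hs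
  have h := (posSemidef_prod ω s).2 x.coeff
  have hval : ∀ a ∈ x.coeff.support, ∀ b ∈ x.coeff.support,
      prodValue ω (star a * b) = ∏ i ∈ s, ω i (star (a.1 i) * b.1 i) := fun a ha b hb => by
    refine finprod_eq_prod_of_mulSupport_subset _ fun i hi => ?_
    by_contra his
    have h1 : ∀ a ∈ x.coeff.support, a.1 i = 1 := fun a ha =>
      FinSupp.eq_one_of_notMem_support a fun h => his (Finset.mem_biUnion.2 ⟨a, ha, h⟩)
    refine hi ?_
    change ω i (star (a.1 i) * b.1 i) = 1
    rw [h1 a ha, h1 b hb, star_one, one_mul]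
    exact (ω i).map_one
  have hx : prodFunctional ω (star x * x) = x.coeff.sum fun a ca => x.coeff.sum fun b cb =>
      star ca * prodValue ω (star a * b) * cb := by
    have h1 : star x = x.coeff.sum fun a c => MonoidAlgebra.single (star a) (star c) := rfl
    have h2 : x = x.coeff.sum fun a c => MonoidAlgebra.single a c := x.sum_coeff_single.symm
    conv_lhs => rw [h1]; arg 2; arg 2; rw [h2]
    simp only [Finsupp.sum, Finset.sum_mul_sum, map_sum]
    refine Finset.sum_congr rfl fun a _ => Finset.sum_congr rfl fun b _ => ?_
    rw [MonoidAlgebra.single_mul_single, prodFunctional_single]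
    ring
  rw [hx]
  refine h.trans_eq ?_
  simp only [Finsupp.sum]
  refine Finset.sum_congr rfl fun a ha => Finset.sum_congr rfl fun b hb => ?_
  rw [hval a ha b hb, Matrix.of_apply]

/-- Multilinearity survives multiplication on both sides. It is used to insert an operator
inequality in one slot, and to show that the GNS seminorm kills the tensor relations. -/
theorem prodFunctional_slot (a : FinSupp A) (i : ι) (w y : FormalTensor A) :
    ∃ L : A i →ₗ[ℂ] ℂ, ∀ x, prodFunctional ω (w * formal (FinSupp.update a i x) * y) = L x := by
  refine formal_induction (p := fun w => ∃ L : A i →ₗ[ℂ] ℂ, ∀ x,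
    prodFunctional ω (w * formal (FinSupp.update a i x) * y) = L x) w (fun b => ?_) ?_ ?_
  · refine formal_induction (p := fun y => ∃ L : A i →ₗ[ℂ] ℂ, ∀ x,
      prodFunctional ω (formal b * formal (FinSupp.update a i x) * y) = L x) y (fun c => ?_) ?_ ?_
    -- For elementary `b` and `c` the slot contributes `ω i (bᵢ x cᵢ)`, and all other slots give a
    -- constant.
    · refine ⟨prodValue ω (FinSupp.update (b * a * c) i 1) •
        ((ω i).toFun ∘ₗ LinearMap.mulRight ℂ (c.1 i) ∘ₗ LinearMap.mulLeft ℂ (b.1 i)), fun x => ?_⟩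
      rw [← formal_mul, ← formal_mul, prodFunctional_formal, ← FinSupp.update_eq_self b i,
        ← FinSupp.update_eq_self c i, FinSupp.update_mul_update, FinSupp.update_mul_update,
        prodValue_update, mul_comm, FinSupp.update_apply_self, FinSupp.update_apply_self,
        FinSupp.update_eq_self, FinSupp.update_eq_self]
      rfl
    · rintro y z ⟨L, hL⟩ ⟨K, hK⟩
      exact ⟨L + K, fun x => by rw [mul_add, map_add, hL, hK, LinearMap.add_apply]⟩
    · rintro c y ⟨L, hL⟩
      exact ⟨c • L, fun x => by rw [mul_smul_comm, map_smul, hL, LinearMap.smul_apply]⟩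
  · rintro y z ⟨L, hL⟩ ⟨K, hK⟩
    exact ⟨L + K, fun x => by rw [add_mul, add_mul, map_add, hL, hK, LinearMap.add_apply]⟩
  · rintro c y ⟨L, hL⟩
    exact ⟨c • L, fun x => by
      rw [smul_mul_assoc, smul_mul_assoc, map_smul, hL, LinearMap.smul_apply]⟩

/-- `c ↦ f (z* c z)`, with `c` in slot `i`, is linear and nonnegative on squares. Evaluated at `‖x‖²
- x* x`, itself a square, it gives the bound. -/
theorem prodFunctional_update_one_le (i : ι) (x : A i) (z : FormalTensor A) :
    (prodFunctional ω (star (formal (FinSupp.update 1 i x) * z) *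
      (formal (FinSupp.update 1 i x) * z))).re ≤ ‖x‖ ^ 2 * (prodFunctional ω (star z * z)).re := by
  obtain ⟨L, hL⟩ := prodFunctional_slot ω 1 i (star z) z
  have h : ∀ c : A i, prodFunctional ω (star (formal (FinSupp.update 1 i c) * z) *
      (formal (FinSupp.update 1 i c) * z)) = L (star c * c) := fun c => by
    rw [← hL, star_mul, star_formal, FinSupp.star_update, star_one, mul_assoc (star z),
      ← mul_assoc (formal _) (formal _), ← formal_mul, FinSupp.update_mul_update, one_mul,
      ← mul_assoc]
  have h1 : prodFunctional ω (star z * z) = L 1 := by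
    rw [← hL, FinSupp.update_one_one, formal_one, mul_one]
  obtain ⟨c, hc⟩ := exists_norm_sq_sub_eq_star_mul_self x
  have hpos := (Complex.nonneg_iff.1 (prodFunctional_nonneg ω
    (formal (FinSupp.update 1 i c) * z))).1
  rw [h, ← hc, map_sub, map_smul, smul_eq_mul, Complex.sub_re, Complex.re_ofReal_mul] at hpos
  rw [h, h1]
  linarith

theorem prodFunctional_formal_le (s : Finset ι) (a : FinSupp A) (ha : ∀ i ∉ s, a.1 i = 1)
    (y : FormalTensor A) : (prodFunctional ω (star (formal a * y) * (formal a * y))).re ≤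
      (∏ i ∈ s, ‖a.1 i‖) ^ 2 * (prodFunctional ω (star y * y)).re := by
  classical
  induction s using Finset.cons_induction_on generalizing a with
  | empty =>
    have : a = 1 := Subtype.ext (funext fun i => ha i (Finset.notMem_empty i))
    rw [this, formal_one, one_mul, Finset.prod_empty, one_pow, one_mul]
  | cons i s hi ih =>
    have hsplit : a = FinSupp.update 1 i (a.1 i) * FinSupp.update a i 1 := by
      rw [FinSupp.update_mul_update, one_mul, mul_one, FinSupp.update_eq_self]
    have h1 := prodFunctional_update_one_le ω i (a.1 i) (formal (FinSupp.update a i 1) * y)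
    rw [← mul_assoc (formal (FinSupp.update 1 i (a.1 i))), ← formal_mul, ← hsplit] at h1
    refine h1.trans ?_
    rw [Finset.prod_cons, mul_pow, mul_assoc]
    refine mul_le_mul_of_nonneg_left ((ih (FinSupp.update a i 1) fun j hj => ?_).trans_eq ?_)
      (by positivity)
    · by_cases h : j = i
      · subst h; exact FinSupp.update_apply_self _ _ _
      · rw [FinSupp.update_apply_of_ne _ h]
        exact ha j fun hj' => (Finset.mem_cons.1 hj').elim h hj
    · refine congrArg (fun t => t ^ 2 * _) (Finset.prod_congr rfl fun j hj => ?_)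
      rw [FinSupp.update_apply_of_ne _ (ne_of_mem_of_not_mem hj hi)]

/-- The bound is known on elementary tensors. It is rewritten for the seminorm `‖toVec ·‖`, since
the triangle inequality extends it to linear combinations, which the squared form does not do
directly. -/
theorem leftBounded_prodFunctional : LeftBounded (prodFunctional ω) := by
  have hf := prodFunctional_nonneg ω
  have hiff : ∀ (x : FormalTensor A) (c : ℝ), 0 ≤ c →
      ((∀ y, (prodFunctional ω (star (x * y) * (x * y))).re ≤
        c ^ 2 * (prodFunctional ω (star y * y)).re) ↔
      ∀ y, ‖toVec hf (x * y)‖ ≤ c * ‖toVec hf y‖) := fun x c hc =>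
    forall_congr' fun y => by
      rw [← norm_toVec_sq hf, ← norm_toVec_sq hf, ← mul_pow]
      exact pow_le_pow_iff_left₀ (norm_nonneg _) (by positivity) two_ne_zero
  intro x
  suffices ∃ c : ℝ, 0 ≤ c ∧ ∀ y, ‖toVec hf (x * y)‖ ≤ c * ‖toVec hf y‖ by
    obtain ⟨c, hc, h⟩ := this
    exact ⟨c, hc, (hiff x c hc).2 h⟩
  refine formal_induction (p := fun x => ∃ c : ℝ, 0 ≤ c ∧ ∀ y,
    ‖toVec hf (x * y)‖ ≤ c * ‖toVec hf y‖) x (fun a => ?_) ?_ ?_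
  · have hc : 0 ≤ ∏ i ∈ a.2.toFinset, ‖a.1 i‖ := Finset.prod_nonneg fun i _ => norm_nonneg _
    exact ⟨_, hc, (hiff _ _ hc).1 (prodFunctional_formal_le ω _ a fun i =>
      FinSupp.eq_one_of_notMem_support a)⟩
  · rintro x x' ⟨c, hc, h⟩ ⟨d, hd, h'⟩
    refine ⟨c + d, add_nonneg hc hd, fun y => ?_⟩
    rw [add_mul, add_mul]
    exact (norm_add_le (toVec hf (x * y)) (toVec hf (x' * y))).trans (add_le_add (h y) (h' y))
  · rintro c x ⟨d, hd, h⟩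
    refine ⟨‖c‖ * d, by positivity, fun y => ?_⟩
    rw [smul_mul_assoc, mul_assoc]
    exact (norm_smul c (toVec hf (x * y))).le.trans
      (mul_le_mul_of_nonneg_left (h y) (norm_nonneg c))

/-- This makes the product functional continuous for the maximal norm: it is dominated by its GNS
seminorm, which takes part in the supremum. -/
theorem gnsSeminorm_prodFunctional_mem :
    gnsSeminorm (prodFunctional_nonneg ω) (leftBounded_prodFunctional ω) ∈
      finTensorSeminorms A := by
  -- An element that `f` annihilates between arbitrary factors acts as zero in the GNS
  -- representation.
  have h0 : ∀ z : FormalTensor A, (∀ w y, prodFunctional ω (w * z * y) = 0) →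
      gnsSeminorm (prodFunctional_nonneg ω) (leftBounded_prodFunctional ω) z = 0 := fun z hz =>
    le_antisymm (gnsSeminorm_le _ _ le_rfl fun y => by
      rw [← mul_assoc, hz]; simp) (CStarSeminorm.nonneg _ _)
  refine ⟨fun a i x y => h0 _ fun w z => ?_, fun a i c x => h0 _ fun w z => ?_, fun a => ?_⟩
  · obtain ⟨L, hL⟩ := prodFunctional_slot ω a i w z
    rw [mul_sub, mul_sub, sub_mul, sub_mul, map_sub, map_sub, hL, hL, hL, map_add]
    ring
  · obtain ⟨L, hL⟩ := prodFunctional_slot ω a i w z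
    rw [mul_sub, sub_mul, map_sub, mul_smul_comm, smul_mul_assoc, map_smul, hL, hL, map_smul,
      sub_self]
  · exact gnsSeminorm_le _ _ (Finset.prod_nonneg fun i _ => norm_nonneg _)
      (prodFunctional_formal_le ω _ a fun i => FinSupp.eq_one_of_notMem_support a)

/-- The product state `⨂ ωᵢ`. -/
def prodState : CState (FinTensor A) :=
  (finTensorSeminorm A).liftState (prodFunctional ω) (prodFunctional_nonneg ω)
    ((prodFunctional_formal ω 1).trans (prodValue_one ω)) fun x =>
      (norm_le_gnsSeminorm (prodFunctional_nonneg ω) (leftBounded_prodFunctional ω)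
        ((prodFunctional_formal ω 1).trans (prodValue_one ω)) x).trans
        (CStarSeminorm.le_sup (gnsSeminorm_prodFunctional_mem ω) x)

theorem prodState_tprod_eq_prodValue (a : FinSupp A) : prodState ω (tprod a) = prodValue ω a :=
  (CStarSeminorm.liftState_toCompletion _ _ _ _ _ _).trans (prodFunctional_formal ω a)

theorem prodState_tprod (a : FinSupp A) : prodState ω (tprod a) = ∏ᶠ i, ω i (a.1 i) :=
  prodState_tprod_eq_prodValue ω a

theorem prodState_embed (i : ι) (x : A i) : prodState ω (embed i x) = ω i x := by
  refine (prodState_tprod ω _).trans ((prodValue_update ω 1 i x).trans ?_)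
  rw [FinSupp.update_one_one, prodValue_one, mul_one]

theorem prodState_embed_mul_embed {i j : ι} (hij : i ≠ j) (x : A i) (y : A j) :
    prodState ω (embed i x * embed j y) = ω i x * ω j y := by
  have hj : (FinSupp.update (1 : FinSupp A) i x).1 j = 1 :=
    FinSupp.update_apply_of_ne _ (Ne.symm hij) _
  have h : FinSupp.update (FinSupp.update (1 : FinSupp A) i x) j 1 = FinSupp.update 1 i x :=
    (congrArg _ hj.symm).trans (FinSupp.update_eq_self _ j)
  have h1 : prodState ω (embed i x * embed j y) =
      prodValue ω (FinSupp.update (FinSupp.update 1 i x) j y) := by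
    rw [← prodState_tprod_eq_prodValue, tprod_update_of_eq_one hj]; rfl
  rw [h1, prodValue_update, h, prodValue_update, FinSupp.update_one_one, prodValue_one, mul_one,
    mul_comm]

end ProductState

/-! ## Vector states on matrix algebras -/

section Matrices

variable {m : Type*} [Fintype m] [DecidableEq m]

/-- The state `M ↦ ⟨v| M |v⟩` of a unit vector. -/
def vectorState (v : m → ℂ) (hv : star v ⬝ᵥ v = 1) : CState (Matrix m m ℂ) where
  toFun :=
    { toFun := fun M => star v ⬝ᵥ (M *ᵥ v)
      map_add' := fun M M' => by rw [Matrix.add_mulVec, dotProduct_add]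
      map_smul' := fun c M => by rw [Matrix.smul_mulVec, dotProduct_smul]; rfl }
  nonneg M := by
    change 0 ≤ star v ⬝ᵥ ((star M * M) *ᵥ v)
    rw [← Matrix.mulVec_mulVec, Matrix.dotProduct_mulVec, Matrix.star_eq_conjTranspose,
      ← Matrix.star_mulVec]
    exact dotProduct_star_self_nonneg _
  map_one := by
    change star v ⬝ᵥ ((1 : Matrix m m ℂ) *ᵥ v) = 1
    rw [Matrix.one_mulVec, hv]

theorem vectorState_apply (v : m → ℂ) (hv : star v ⬝ᵥ v = 1) (M : Matrix m m ℂ) :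
    vectorState v hv M = star v ⬝ᵥ (M *ᵥ v) := rfl

variable {l : Type*} [Fintype l] [DecidableEq l]

/-- The *-homomorphism `M ↦ M ⊗ 1` on matrices. -/
def kroneckerLeft : Matrix m m ℂ →⋆ₐ[ℂ] Matrix (m × l) (m × l) ℂ where
  toFun M := M ⊗ₖ (1 : Matrix l l ℂ)
  map_one' := Matrix.one_kronecker_one
  map_mul' M M' := by rw [← Matrix.mul_kronecker_mul, one_mul]
  map_zero' := Matrix.zero_kronecker _
  map_add' M M' := Matrix.add_kronecker _ _ _
  commutes' c := by
    rw [Algebra.algebraMap_eq_smul_one, Matrix.smul_kronecker, Matrix.one_kronecker_one,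
      Algebra.algebraMap_eq_smul_one]
  map_star' M := by
    rw [Matrix.star_eq_conjTranspose, Matrix.star_eq_conjTranspose,
      Matrix.conjTranspose_kronecker, Matrix.conjTranspose_one]

/-- The *-homomorphism `M ↦ 1 ⊗ M` on matrices. -/
def kroneckerRight : Matrix l l ℂ →⋆ₐ[ℂ] Matrix (m × l) (m × l) ℂ where
  toFun M := (1 : Matrix m m ℂ) ⊗ₖ M
  map_one' := Matrix.one_kronecker_one
  map_mul' M M' := by rw [← Matrix.mul_kronecker_mul, one_mul]
  map_zero' := Matrix.kronecker_zero _
  map_add' M M' := Matrix.kronecker_add _ _ _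
  commutes' c := by
    rw [Algebra.algebraMap_eq_smul_one, Matrix.kronecker_smul, Matrix.one_kronecker_one,
      Algebra.algebraMap_eq_smul_one]
  map_star' M := by
    rw [Matrix.star_eq_conjTranspose, Matrix.star_eq_conjTranspose,
      Matrix.conjTranspose_kronecker, Matrix.conjTranspose_one]

theorem kroneckerLeft_mul_kroneckerRight (M : Matrix m m ℂ) (M' : Matrix l l ℂ) :
    kroneckerLeft (l := l) M * kroneckerRight (m := m) M' = M ⊗ₖ M' := by
  change (M ⊗ₖ (1 : Matrix l l ℂ)) * ((1 : Matrix m m ℂ) ⊗ₖ M') = _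
  rw [← Matrix.mul_kronecker_mul, one_mul, mul_one]

/-- The *-homomorphism `M ⊗ M' ↦ M ⊗ₖ M'` on the maximal tensor product of matrix algebras. -/
def kroneckerHom : MaxTensor (Matrix m m ℂ) (Matrix l l ℂ) →⋆ₐ[ℂ] Matrix (m × l) (m × l) ℂ :=
  MaxTensor.lift kroneckerLeft kroneckerRight fun M M' => by
    rw [Commute, SemiconjBy, kroneckerLeft_mul_kroneckerRight]
    change _ = ((1 : Matrix m m ℂ) ⊗ₖ M') * (M ⊗ₖ (1 : Matrix l l ℂ))
    rw [← Matrix.mul_kronecker_mul, one_mul, mul_one]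

theorem kroneckerHom_tmul (M : Matrix m m ℂ) (M' : Matrix l l ℂ) :
    kroneckerHom (tmul M M') = M ⊗ₖ M' :=
  (MaxTensor.lift_tmul _ _ _ M M').trans (kroneckerLeft_mul_kroneckerRight M M')

end Matrices

/-! ### Bipartite qubit states -/

section Qubits

variable {n : ℕ}

/-- The state `⟨φ| M ⊗ M' |φ⟩` of a bipartite unit vector. -/
def pairState (φ : BiVec n) (hφ : star φ ⬝ᵥ φ = 1) : CState (MaxTensor (Mat n) (Mat n)) :=
  (vectorState φ hφ).comap kroneckerHom

theorem pairState_tmul (φ : BiVec n) (hφ : star φ ⬝ᵥ φ = 1) (M M' : Mat n) :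
    pairState φ hφ (tmul M M') = expect φ M M' := by
  unfold pairState expect
  rw [CState.comap_apply, kroneckerHom_tmul, vectorState_apply]

/-- The vector `|00⟩`. -/
def ketZero (n : ℕ) : BiVec n := Pi.single (0, 0) 1

theorem ketZero_unit : star (ketZero n) ⬝ᵥ ketZero n = 1 := by
  simp [ketZero]

theorem expect_ketZero (M M' : Mat n) :
    expect (ketZero n) M M' = expectZero M * expectZero M' := by
  simp [expect, ketZero, expectZero, Matrix.kroneckerMap_apply]

theorem ket_unit (q : SchmidtVec n) : star q.ket ⬝ᵥ q.ket = 1 := by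
  have h := q.2.2
  rw [dotProduct, Fintype.sum_prod_type]
  simp only [SchmidtVec.ket, Pi.star_apply]
  have : ∀ i j : Fin (2 ^ n), (star (if i = j then (q.1 i : ℂ) else 0) *
      if i = j then (q.1 i : ℂ) else 0) = if i = j then ((q.1 i ^ 2 : ℝ) : ℂ) else 0 := fun i j => by
    split_ifs
    · rw [RCLike.star_def, Complex.conj_ofReal]; push_cast; ring
    · simp
  simp only [this, Finset.sum_ite_eq, Finset.mem_univ, if_true]
  rw [← Complex.ofReal_sum, h, Complex.ofReal_one]

/-- Passage from the Schrödinger to the Heisenberg picture; the right-hand side has the conjugations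
performed by `applyUnitary`. -/
theorem expect_localRotate (U V : Mat n) (φ : BiVec n) (M M' : Mat n) :
    expect (localRotate U V φ) M M' = expect φ (star U * M * U) (star V * M' * V) := by
  unfold expect localRotate
  rw [Matrix.star_mulVec, ← Matrix.dotProduct_mulVec, Matrix.mulVec_mulVec, Matrix.mulVec_mulVec,
    Matrix.conjTranspose_kronecker, ← Matrix.mul_kronecker_mul, ← Matrix.mul_kronecker_mul,
    Matrix.star_eq_conjTranspose, Matrix.star_eq_conjTranspose, mul_assoc, mul_assoc]

theorem star_dotProduct_self (φ : BiVec n) : star φ ⬝ᵥ φ = ((∑ p, ‖φ p‖ ^ 2 : ℝ) : ℂ) := by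
  rw [dotProduct, Complex.ofReal_sum]
  refine Finset.sum_congr rfl fun p _ => ?_
  rw [Pi.star_apply, RCLike.star_def, Complex.conj_mul', Complex.ofReal_pow]

end Qubits

/-! ## The Schmidt decomposition -/

section Schmidt

variable {m : Type*} [Fintype m] [DecidableEq m]

theorem of_orthonormalBasis_mem_unitaryGroup (e : OrthonormalBasis m ℂ (EuclideanSpace ℂ m)) :
    (Matrix.of fun i k => e k i) ∈ Matrix.unitaryGroup m ℂ := by
  rw [Matrix.mem_unitaryGroup_iff']
  ext i j
  have h := orthonormal_iff_ite.1 e.orthonormal i j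
  rw [PiLp.inner_apply] at h
  rw [Matrix.mul_apply, Matrix.one_apply, ← h]
  refine Finset.sum_congr rfl fun k _ => ?_
  rw [Matrix.star_apply, Matrix.of_apply, Matrix.of_apply, RCLike.inner_apply, mul_comm]
  rfl

/-- The singular value decomposition of a square matrix. -/
theorem exists_svd (Φ : Matrix m m ℂ) : ∃ (U W : Matrix.unitaryGroup m ℂ) (q : m → ℝ),
    (∀ i, 0 ≤ q i) ∧ Φ = U.1 * Matrix.diagonal (fun i => (q i : ℂ)) * star W.1 := by
  have hH := Matrix.posSemidef_conjTranspose_mul_self Φ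
  set b := hH.1.eigenvectorBasis
  set ev := hH.1.eigenvalues
  have hev : ∀ i, 0 ≤ ev i := hH.eigenvalues_nonneg
  -- The images under `Φ` of an eigenbasis of `Φ* Φ`. They are mutually orthogonal, with squared
  -- norms the eigenvalues.
  let w : m → EuclideanSpace ℂ m := fun k => WithLp.toLp 2 (Φ *ᵥ (b k).ofLp)
  have hw : ∀ i j, inner ℂ (w i) (w j) = if i = j then (ev j : ℂ) else 0 := fun i j => by
    have h1 : inner ℂ (w i) (w j) = inner ℂ (b i) (WithLp.toLp 2 ((Φᴴ * Φ) *ᵥ (b j).ofLp)) := by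
      rw [EuclideanSpace.inner_eq_star_dotProduct, EuclideanSpace.inner_eq_star_dotProduct]
      change (Φ *ᵥ (b j).ofLp) ⬝ᵥ star (Φ *ᵥ (b i).ofLp) = ((Φᴴ * Φ) *ᵥ (b j).ofLp) ⬝ᵥ star (b i).ofLp
      rw [dotProduct_comm, Matrix.star_mulVec, ← Matrix.dotProduct_mulVec, Matrix.mulVec_mulVec,
        dotProduct_comm]
    rw [h1, hH.1.mulVec_eigenvectorBasis]
    change inner ℂ (b i) ((ev j : ℝ) • b j) = _
    rw [← Complex.coe_smul, inner_smul_right, orthonormal_iff_ite.1 b.orthonormal]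
    simp
  -- The left singular vectors. Where the eigenvalue vanishes the formula gives `0`, so only the
  -- remaining indices enter the orthonormal family; the others are filled by extending it to a
  -- basis.
  let u : m → EuclideanSpace ℂ m := fun k => ((Real.sqrt (ev k))⁻¹ : ℂ) • w k
  have hu : Orthonormal ℂ (Set.domRestrict {k | ev k ≠ 0} u) := by
    rw [orthonormal_iff_ite]
    rintro ⟨i, hi⟩ ⟨j, hj⟩
    change inner ℂ (u i) (u j) = _
    rw [inner_smul_left, inner_smul_right, hw]
    by_cases hij : i = j
    · subst hij
      have h2 : (Real.sqrt (ev i) : ℂ) * Real.sqrt (ev i) = ev i := by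
        rw [← Complex.ofReal_mul, Real.mul_self_sqrt (hev i)]
      have h3 : (Real.sqrt (ev i) : ℂ) ≠ 0 := by
        rw [Complex.ofReal_ne_zero]
        exact (Real.sqrt_ne_zero (hev i)).2 hi
      simp only [if_true, map_inv₀, Complex.conj_ofReal]
      rw [← h2]
      field_simp
    · simp [hij]
  obtain ⟨e, he⟩ := hu.exists_orthonormalBasis_extension_of_card_eq (by simp)
  refine ⟨⟨_, of_orthonormalBasis_mem_unitaryGroup e⟩, ⟨_, of_orthonormalBasis_mem_unitaryGroup b⟩,
    fun k => Real.sqrt (ev k), fun k => Real.sqrt_nonneg _, ?_⟩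
  have hWW : (Matrix.of fun i k => b k i) * star (Matrix.of fun i k => b k i) = 1 :=
    Matrix.mem_unitaryGroup_iff.1 (of_orthonormalBasis_mem_unitaryGroup b)
  -- The decomposition in the form `Φ W = U D`, column by column. At a zero eigenvalue both columns
  -- vanish, whatever basis vector was chosen there.
  have key : Φ * (Matrix.of fun i k => b k i) =
      (Matrix.of fun i k => e k i) * Matrix.diagonal (fun i => (Real.sqrt (ev i) : ℂ)) := by
    ext i k
    rw [Matrix.mul_diagonal, Matrix.of_apply]
    change w k i = _
    by_cases hk : ev k = 0
    · have : w k = 0 := by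
        rw [← inner_self_eq_zero (𝕜 := ℂ), hw]; simp [hk]
      rw [this, hk]; simp
    · rw [he k hk]
      have h3 : (Real.sqrt (ev k) : ℂ) ≠ 0 := by
        rw [Complex.ofReal_ne_zero]
        exact (Real.sqrt_ne_zero (hev k)).2 hk
      change w k i = ((Real.sqrt (ev k))⁻¹ : ℂ) * w k i * _
      field_simp
  rw [← key, mul_assoc, hWW, mul_one]

/-- Every bipartite unit vector has a Schmidt decomposition. -/
theorem exists_schmidt {n : ℕ} (φ : BiVec n) (hφ : ∑ p, ‖φ p‖ ^ 2 = 1) :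
    ∃ (q : SchmidtVec n) (U V : Matrix.unitaryGroup (Fin (2 ^ n)) ℂ),
      φ = localRotate U.1 V.1 q.ket := by
  obtain ⟨U, W, q, hq, h⟩ := exists_svd (Matrix.of fun i j => φ (i, j))
  -- The second unitary is the entrywise conjugate of `W`, because the `(i, j)` entry of `U D W*` is
  -- `∑ₖ Uᵢₖ qₖ conj(Wⱼₖ)`.
  have hV : W.1.map star ∈ Matrix.unitaryGroup (Fin (2 ^ n)) ℂ := by
    have := Matrix.mem_unitaryGroup_iff'.1 W.2
    rw [Matrix.mem_unitaryGroup_iff']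
    ext i j
    have h := congrFun (congrFun this j) i
    rw [Matrix.mul_apply] at h ⊢
    rw [← Matrix.transpose_one, Matrix.transpose_apply, ← h]
    refine Finset.sum_congr rfl fun k _ => ?_
    simp [Matrix.star_apply, mul_comm]
  have hrot : φ = localRotate U.1 (W.1.map star)
      (fun p => if p.1 = p.2 then (q p.1 : ℂ) else 0) := by
    ext ⟨i, j⟩
    have hij := congrFun (congrFun h i) j
    rw [Matrix.of_apply, Matrix.mul_apply] at hij
    rw [hij, localRotate, Matrix.mulVec, dotProduct, Fintype.sum_prod_type]
    refine Finset.sum_congr rfl fun k _ => ?_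
    rw [Finset.sum_eq_single k]
    · rw [Matrix.mul_diagonal, Matrix.kroneckerMap_apply, if_pos rfl, Matrix.map_apply,
        Matrix.star_apply]
      ring
    · intro l _ hl
      rw [if_neg (Ne.symm hl), mul_zero]
    · simp
  -- Local unitaries preserve the norm: `expect φ 1 1` is computed before and after removing them.
  have hsum : ∑ i, q i ^ 2 = 1 := by
    have h1 : expect φ 1 1 = 1 := by
      unfold expect
      rw [Matrix.one_kronecker_one, Matrix.one_mulVec, star_dotProduct_self, hφ, Complex.ofReal_one]
    rw [hrot, expect_localRotate, mul_one, mul_one, Matrix.mem_unitaryGroup_iff'.1 U.2,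
      Matrix.mem_unitaryGroup_iff'.1 hV, expect, Matrix.one_kronecker_one, Matrix.one_mulVec,
      star_dotProduct_self, Fintype.sum_prod_type, Complex.ofReal_eq_one] at h1
    rw [← h1]
    refine Finset.sum_congr rfl fun i _ => ?_
    rw [Finset.sum_eq_single i]
    · simp
    · intro l _ hl
      simp [Ne.symm hl]
    · simp
  exact ⟨⟨q, hq, hsum⟩, U, ⟨_, hV⟩, hrot⟩

end Schmidt

/-! ## Functoriality of the finitely supported tensor product -/

section Map

variable {ι : Type*} {A B : ι → Type*} [∀ i, CStarAlgebra (A i)] [∀ i, CStarAlgebra (B i)]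

/-- Apply unital *-homomorphisms entrywise to a finitely supported family. -/
def FinSupp.map (f : ∀ i, A i →⋆ₐ[ℂ] B i) (a : FinSupp A) : FinSupp B :=
  ⟨fun i => f i (a.1 i), a.2.subset fun i hi h => hi (by
    change f i (a.1 i) = 1
    rw [h, map_one])⟩

theorem FinSupp.map_apply (f : ∀ i, A i →⋆ₐ[ℂ] B i) (a : FinSupp A) (i : ι) :
    (FinSupp.map f a).1 i = f i (a.1 i) := rfl

/-- The tensor product `⨂ fᵢ` of *-homomorphisms. -/
def FinTensor.map (f : ∀ i, A i →⋆ₐ[ℂ] B i) : FinTensor A →⋆ₐ[ℂ] FinTensor B :=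
  FinTensor.lift (fun i => (embedHom i).comp (f i)) fun _ _ hij _ _ => commute_embed hij _ _

theorem FinTensor.map_embed (f : ∀ i, A i →⋆ₐ[ℂ] B i) (i : ι) (x : A i) :
    FinTensor.map f (embed i x) = embed i (f i x) :=
  FinTensor.lift_embed _ _ i x

theorem FinTensor.map_tprod (f : ∀ i, A i →⋆ₐ[ℂ] B i) (a : FinSupp A) :
    FinTensor.map f (tprod a) = tprod (FinSupp.map f a) := by
  refine FinSupp.induction (p := fun a => FinTensor.map f (tprod a) = tprod (FinSupp.map f a)) a
    ?_ fun a i x ha ih => ?_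
  · rw [tprod_one, map_one, ← tprod_one]
    exact congrArg tprod (Subtype.ext (funext fun i => (map_one (f i)).symm))
  · have h : FinSupp.map f (FinSupp.update a i x) =
        FinSupp.update (FinSupp.map f a) i (f i x) :=
      FinSupp.ext_of_ne i
        (by rw [FinSupp.map_apply, FinSupp.update_apply_self, FinSupp.update_apply_self])
        fun j hj => by
          rw [FinSupp.map_apply, FinSupp.update_apply_of_ne _ hj, FinSupp.update_apply_of_ne _ hj,
            FinSupp.map_apply]
    rw [tprod_update_of_eq_one ha, map_mul, ih, FinTensor.map_embed, h, tprod_update_of_eq_one]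
    rw [FinSupp.map_apply, ha, map_one]

/-- At different indices the generators lie in different factors; at the same index they commute as
`a ⊗ 1` and `1 ⊗ b`. -/
theorem commute_map_inl_map_inr (x : FinTensor A) (y : FinTensor B) :
    Commute (FinTensor.map (fun i => MaxTensor.inl (A i) (B i)) x)
      (FinTensor.map (fun i => MaxTensor.inr (A i) (B i)) y) := by
  refine FinTensor.commute_of_forall _ _ (fun i a => ?_) x
  refine (FinTensor.commute_of_forall _ _ (fun j b => ?_) y).symm
  rw [FinTensor.map_embed, FinTensor.map_embed]
  by_cases hij : i = j
  · subst hij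
    rw [← embedHom_apply, ← embedHom_apply, Commute, SemiconjBy, ← map_mul, ← map_mul,
      (MaxTensor.commute_inl_inr a b).eq]
  · exact commute_embed (Ne.symm hij) _ _

/-- The *-homomorphism `⨂ aᵢ ⊗ ⨂ bᵢ ↦ ⨂ (aᵢ ⊗ bᵢ)`. -/
def FinTensor.zip :
    MaxTensor (FinTensor A) (FinTensor B) →⋆ₐ[ℂ] FinTensor fun i => MaxTensor (A i) (B i) :=
  MaxTensor.lift (FinTensor.map fun i => MaxTensor.inl (A i) (B i))
    (FinTensor.map fun i => MaxTensor.inr (A i) (B i)) commute_map_inl_map_inr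

theorem FinTensor.zip_tmul_tprod (a : FinSupp A) (b : FinSupp B) :
    FinTensor.zip (tmul (tprod a) (tprod b)) =
      tprod (FinSupp.map (fun i => MaxTensor.inl (A i) (B i)) a *
        FinSupp.map (fun i => MaxTensor.inr (A i) (B i)) b) := by
  rw [FinTensor.zip, MaxTensor.lift_tmul, FinTensor.map_tprod, FinTensor.map_tprod, tprod_mul]

/-- The product of states on the `Aᵢ ⊗ Bᵢ`, as a state on `(⨂ Aᵢ) ⊗ (⨂ Bᵢ)`. -/
def zipState (ω : ∀ i, CState (MaxTensor (A i) (B i))) :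
    CState (MaxTensor (FinTensor A) (FinTensor B)) :=
  (prodState ω).comap FinTensor.zip

theorem zipState_tmul_tprod (ω : ∀ i, CState (MaxTensor (A i) (B i))) (a : FinSupp A)
    (b : FinSupp B) :
    zipState ω (tmul (tprod a) (tprod b)) = ∏ᶠ i, ω i (tmul (a.1 i) (b.1 i)) := by
  rw [zipState, CState.comap_apply, FinTensor.zip_tmul_tprod, prodState_tprod]
  refine finprod_congr fun i => ?_
  rw [FinSupp.mul_apply, FinSupp.map_apply, FinSupp.map_apply, MaxTensor.inl_mul_inr]

theorem hasFiniteMulSupport_zip (ω : ∀ i, CState (MaxTensor (A i) (B i))) (a : FinSupp A)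
    (b : FinSupp B) : Function.HasFiniteMulSupport fun i => ω i (tmul (a.1 i) (b.1 i)) :=
  (a.2.union b.2).subset fun i hi => by
    by_contra h
    simp only [Set.mem_union, Set.mem_ofPred_eq, not_or, not_not] at h
    refine hi ?_
    change ω i (tmul (a.1 i) (b.1 i)) = 1
    rw [h.1, h.2, tmul_one_one]
    exact (ω i).map_one

end Map

/-! ## Product states on a maximal tensor product -/

section TensorState

universe u

variable {C D : Type u} [CStarAlgebra C] [CStarAlgebra D]

/-- Two C*-algebras as a family indexed by `Bool`. -/
def PairFamily (C D : Type u) : Bool → Type u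
  | true => C
  | false => D

instance : ∀ b, CStarAlgebra (PairFamily C D b)
  | true => inferInstanceAs (CStarAlgebra C)
  | false => inferInstanceAs (CStarAlgebra D)

/-- Two states as a family indexed by `Bool`. -/
def pairStates (s : CState C) (t : CState D) : ∀ b, CState (PairFamily C D b)
  | true => s
  | false => t

variable (C D) in
/-- The embedding of the first algebra into the tensor product of the family `C, D`. -/
def pairLeft : C →⋆ₐ[ℂ] FinTensor (PairFamily C D) := embedHom (A := PairFamily C D) true

variable (C D) in
/-- The embedding of the second algebra into the tensor product of the family `C, D`. -/
def pairRight : D →⋆ₐ[ℂ] FinTensor (PairFamily C D) := embedHom (A := PairFamily C D) false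

theorem pairLeft_apply (c : C) : pairLeft C D c = embed (A := PairFamily C D) true c := rfl

theorem pairRight_apply (d : D) : pairRight C D d = embed (A := PairFamily C D) false d := rfl

theorem commute_pairLeft_pairRight (c : C) (d : D) :
    Commute (pairLeft C D c) (pairRight C D d) := by
  rw [pairLeft_apply, pairRight_apply]
  exact commute_embed (A := PairFamily C D) (i := true) (j := false) (by decide) _ _

/-- The canonical map of `C ⊗ D` to the tensor product of the family `C, D`. -/
def toPairFamily : MaxTensor C D →⋆ₐ[ℂ] FinTensor (PairFamily C D) :=
  MaxTensor.lift (pairLeft C D) (pairRight C D) commute_pairLeft_pairRight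

/-- The product state `s ⊗ t`. -/
def tensorState (s : CState C) (t : CState D) : CState (MaxTensor C D) :=
  (prodState (pairStates s t)).comap toPairFamily

/-- Treating the two algebras as a family reuses the positivity and boundedness of `prodState`; for
the pullback, `toPairFamily` only has to be a homomorphism. -/
theorem tensorState_tmul (s : CState C) (t : CState D) (c : C) (d : D) :
    tensorState s t (tmul c d) = s c * t d := by
  rw [tensorState, CState.comap_apply, toPairFamily, MaxTensor.lift_tmul]
  exact prodState_embed_mul_embed (pairStates s t) (i := true) (j := false) (by decide) _ _

end TensorState

/-! ### Reordering tensor factors -/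

section Interchange

variable {A B M N : Type*} [CStarAlgebra A] [CStarAlgebra B] [CStarAlgebra M] [CStarAlgebra N]

/-- The reordering `(A ⊗ M) ⊗ (B ⊗ N) → (A ⊗ B) ⊗ (M ⊗ N)` of tensor factors. -/
def MaxTensor.interchange :
    MaxTensor (MaxTensor A M) (MaxTensor B N) →⋆ₐ[ℂ] MaxTensor (MaxTensor A B) (MaxTensor M N) :=
  MaxTensor.lift (MaxTensor.map (MaxTensor.inl A B) (MaxTensor.inl M N))
    (MaxTensor.map (MaxTensor.inr A B) (MaxTensor.inr M N)) fun x y => by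
      have key : ∀ a m b n, Commute
          (MaxTensor.map (MaxTensor.inr A B) (MaxTensor.inr M N) (tmul b n))
          (MaxTensor.map (MaxTensor.inl A B) (MaxTensor.inl M N) (tmul a m)) := fun a m b n => by
        rw [Commute, SemiconjBy, MaxTensor.map_tmul, MaxTensor.map_tmul, tmul_mul, tmul_mul,
          (MaxTensor.commute_inl_inr a b).eq, (MaxTensor.commute_inl_inr m n).eq]
      refine MaxTensor.commute_of_forall _ _ (fun a => ?_) (fun m => ?_) x
      · exact (MaxTensor.commute_of_forall _ _ (fun b => key _ _ _ _) (fun n => key _ _ _ _) y).symm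
      · exact (MaxTensor.commute_of_forall _ _ (fun b => key _ _ _ _) (fun n => key _ _ _ _) y).symm

theorem MaxTensor.interchange_tmul (a : A) (m : M) (b : B) (n : N) :
    MaxTensor.interchange (tmul (tmul a m) (tmul b n)) = tmul (tmul a b) (tmul m n) := by
  rw [MaxTensor.interchange, MaxTensor.lift_tmul, MaxTensor.map_tmul, MaxTensor.map_tmul, tmul_mul,
    MaxTensor.inl_mul_inr, MaxTensor.inl_mul_inr]

end Interchange

/-! ## The catalyst -/

section Catalyst

/-- The register state at one site. -/
def siteState {n : ℕ} (q : SchmidtVec n) (i : ℤ) : CState (MaxTensor (Mat n) (Mat n)) :=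
  if i ≤ 0 then pairState (ketZero n) ketZero_unit else pairState q.ket (ket_unit q)

theorem siteState_tmul {n : ℕ} (q : SchmidtVec n) (i : ℤ) (M M' : Mat n) :
    siteState q i (tmul M M') =
      if i ≤ 0 then expectZero M * expectZero M' else expect q.ket M M' := by
  unfold siteState
  split_ifs
  · rw [pairState_tmul, expect_ketZero]
  · rw [pairState_tmul]

/-- The state of the register of `q`. -/
def registerState {n : ℕ} (q : SchmidtVec n) : CState (MaxTensor (RegAlg n) (RegAlg n)) :=
  zipState (siteState q)

theorem registerState_tmul_tprod {n : ℕ} (q : SchmidtVec n) (a b : FinSupp fun _ : ℤ => Mat n) :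
    registerState q (tmul (tprod a) (tprod b)) = ∏ᶠ i : ℤ, siteState q i (tmul (a.1 i) (b.1 i)) :=
  zipState_tmul_tprod _ a b

theorem isRegisterState_registerState {n : ℕ} (q : SchmidtVec n) :
    IsRegisterState q (registerState q) := fun a b => by
  rw [registerState_tmul_tprod]
  exact finprod_congr fun i => siteState_tmul q i _ _

/-- The universal catalyst: the product of all register states. -/
def catalyst : CState (MaxTensor Hotel Hotel) :=
  zipState fun r : Register => registerState r.2

theorem catalyst_tmul_tprod (a b : FinSupp fun r : Register => RegAlg r.1) :
    catalyst (tmul (tprod a) (tprod b)) = ∏ᶠ r, registerState r.2 (tmul (a.1 r) (b.1 r)) :=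
  zipState_tmul_tprod _ a b

theorem isCatalyst_catalyst : IsCatalyst catalyst :=
  ⟨fun r => registerState r.2, fun r => isRegisterState_registerState r.2, catalyst_tmul_tprod⟩

end Catalyst

/-! ## Non-separability -/

section Separability

/-- The pure state of a basis vector. -/
def basisState {n : ℕ} (k : Fin (2 ^ n)) : CState (Mat n) :=
  vectorState (Pi.single k 1) (by simp)

theorem basisState_apply {n : ℕ} (k : Fin (2 ^ n)) (M : Mat n) : basisState k M = M k k := by
  rw [basisState, vectorState_apply]; simp

/-- The second basis vector. -/
def secondIndex (n : ℕ+) : Fin (2 ^ (n : ℕ)) := ⟨1, Nat.one_lt_two_pow n.ne_zero⟩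

/-- The product state with the first basis vector throughout register `r` and the second in all
others takes the values 1 and 0 on the two projections, and states are contractive. A second basis
vector exists because `n ≥ 1`. -/
theorem one_le_dist_site {r r' : Register} (h : r ≠ r') :
    1 ≤ dist (site r 0 (Matrix.single 0 0 1)) (site r' 0 (Matrix.single 0 0 1)) := by
  classical
  let ω : ∀ t : Register, CState (RegAlg t.1) := fun t =>
    prodState fun _ : ℤ => if t = r then basisState 0 else basisState (secondIndex t.1)
  have h1 : prodState ω (site r 0 (Matrix.single 0 0 1)) = 1 := by
    rw [site, prodState_embed, prodState_embed, if_pos rfl, basisState_apply,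
      Matrix.single_apply_same]
  have h2 : prodState ω (site r' 0 (Matrix.single 0 0 1)) = 0 := by
    rw [site, prodState_embed, prodState_embed, if_neg (Ne.symm h), basisState_apply]
    refine Matrix.single_apply_of_ne _ _ _ _ _ fun hk => ?_
    have : (0 : ℕ) = 1 := congrArg Fin.val hk.1
    exact zero_ne_one this
  have h3 := (prodState ω).norm_le
    (site r 0 (Matrix.single 0 0 1) - site r' 0 (Matrix.single 0 0 1))
  rw [map_sub, h1, h2, sub_zero, norm_one] at h3
  rwa [dist_eq_norm]

/-- The Schmidt vector `(√t, √(1 - t))` of two qubits. -/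
def qubitSchmidt (t : Set.Icc (0 : ℝ) 1) : SchmidtVec ((1 : ℕ+) : ℕ) :=
  ⟨![Real.sqrt t, Real.sqrt (1 - t)], by
    have h0 := t.2.1
    have h1 : 0 ≤ 1 - (t : ℝ) := sub_nonneg.2 t.2.2
    refine ⟨fun i => ?_, ?_⟩
    · fin_cases i
      · exact Real.sqrt_nonneg _
      · exact Real.sqrt_nonneg _
    · change ∑ i : Fin 2, _ = _
      rw [Fin.sum_univ_two]
      change Real.sqrt t ^ 2 + Real.sqrt (1 - t) ^ 2 = 1
      rw [Real.sq_sqrt h0, Real.sq_sqrt h1]; ring⟩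

theorem qubitSchmidt_injective : Function.Injective qubitSchmidt := fun t t' h => by
  have h0 : Real.sqrt t = Real.sqrt t' := congrFun (congrArg Subtype.val h) (0 : Fin 2)
  exact Subtype.ext ((Real.sqrt_inj t.2.1 t'.2.1).1 h0)

/-- The single-qubit Schmidt vectors alone contain a copy of the interval `[0, 1]`. -/
theorem not_countable_register : ¬ Countable Register := fun h => by
  have hinj : Function.Injective fun t : Set.Icc (0 : ℝ) 1 => (⟨1, qubitSchmidt t⟩ : Register) :=
    fun t t' h => qubitSchmidt_injective (eq_of_heq (Sigma.mk.inj h).2)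
  have hc : Countable (Set.Icc (0 : ℝ) 1) := hinj.countable
  exact Cardinal.Real.Icc_countable_iff.not.2 (by norm_num) (Set.countable_coe_iff.1 hc)

/-- The balls of radius 1/2 around the site projections form an uncountable disjoint family of
nonempty open sets. -/
theorem not_separableSpace_hotel : ¬ TopologicalSpace.SeparableSpace Hotel := fun h => by
  refine not_countable_register (Pairwise.countable_of_isOpen_disjoint
    (s := fun r : Register => Metric.ball (site r 0 (Matrix.single 0 0 1)) (1 / 2))
    (fun r r' hr => Metric.ball_disjoint_ball ?_) (fun r => Metric.isOpen_ball)
    fun r => Metric.nonempty_ball.2 (by norm_num))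
  have := one_le_dist_site hr
  norm_num
  exact this

end Separability

/-! ## Comparing *-homomorphisms away from one factor -/

section AwayFrom

variable {ι : Type*} {A : ι → Type*} [∀ i, CStarAlgebra (A i)] {C : Type*} [CStarAlgebra C]

theorem FinSupp.update_comm (a : FinSupp A) {i j : ι} (h : i ≠ j) (x : A i) (y : A j) :
    update (update a i x) j y = update (update a j y) i x := by
  refine ext_of_ne i ?_ fun k hk => ?_
  · rw [update_apply_of_ne _ h, update_apply_self, update_apply_self]
  · rw [update_apply_of_ne _ hk]
    by_cases hkj : k = j
    · subst hkj; rw [update_apply_self, update_apply_self]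
    · rw [update_apply_of_ne _ hkj, update_apply_of_ne _ hkj, update_apply_of_ne _ hk]

/-- A tensor with entry `1` at `i` is a product of elements from the other factors. With it the swap
is seen to act trivially away from the swapped site and register. -/
theorem FinTensor.eq_on_tprod_update {f g : FinTensor A →⋆ₐ[ℂ] C} (i : ι)
    (h : ∀ j ≠ i, ∀ x, f (embed j x) = g (embed j x)) (a : FinSupp A) :
    f (tprod (FinSupp.update a i 1)) = g (tprod (FinSupp.update a i 1)) := by
  refine FinSupp.induction (p := fun a =>
    f (tprod (FinSupp.update a i 1)) = g (tprod (FinSupp.update a i 1))) a ?_ fun a j x ha ih => ?_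
  · rw [FinSupp.update_one_one, tprod_one, map_one, map_one]
  · by_cases hj : j = i
    · subst hj; rwa [FinSupp.update_update]
    · rw [FinSupp.update_comm _ hj, tprod_update_of_eq_one, map_mul, map_mul, ih, h j hj]
      rwa [FinSupp.update_apply_of_ne _ hj]

end AwayFrom

/-! ## The shift -/

section Shift

/-- The shift of a register by `k` sites. -/
def registerShift (n : ℕ) (k : ℤ) : RegAlg n →⋆ₐ[ℂ] RegAlg n :=
  FinTensor.lift (A := fun _ : ℤ => Mat n)
    (fun i => embedHom (A := fun _ : ℤ => Mat n) (i + k)) fun _ _ hij _ _ =>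
      commute_embed (A := fun _ : ℤ => Mat n) (fun h => hij (add_right_cancel h)) _ _

theorem registerShift_embed (n : ℕ) (k i : ℤ) (M : Mat n) :
    registerShift n k (embed (A := fun _ : ℤ => Mat n) i M) =
      embed (A := fun _ : ℤ => Mat n) (i + k) M :=
  FinTensor.lift_embed (A := fun _ : ℤ => Mat n) _ _ i M

theorem registerShift_comp (n : ℕ) {k l : ℤ} (h : k + l = 0) (x : RegAlg n) :
    registerShift n l (registerShift n k x) = x := by
  have : (registerShift n l).comp (registerShift n k) = StarAlgHom.id ℂ _ :=
    FinTensor.hom_ext (A := fun _ : ℤ => Mat n) fun i M => by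
      rw [StarAlgHom.comp_apply, registerShift_embed, registerShift_embed, add_assoc, h, add_zero]
      rfl
  exact congrArg (fun f => f x) this

/-- The family `i ↦ c (i - 1)`. -/
def shiftFamily {n : ℕ} (c : FinSupp fun _ : ℤ => Mat n) : FinSupp fun _ : ℤ => Mat n :=
  ⟨fun i => c.1 (i - 1), c.2.preimage (f := fun i : ℤ => i - 1)
    fun _ _ _ _ h => sub_left_injective h⟩

theorem registerShift_tprod {n : ℕ} (c : FinSupp fun _ : ℤ => Mat n) :
    registerShift n 1 (tprod c) = tprod (shiftFamily c) := by
  refine FinSupp.induction (p := fun c => registerShift n 1 (tprod c) = tprod (shiftFamily c)) c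
    ?_ fun c i M hc ih => ?_
  · rw [tprod_one, map_one, ← tprod_one]; rfl
  · have h : shiftFamily (FinSupp.update c i M) = FinSupp.update (shiftFamily c) (i + 1) M := by
      refine FinSupp.ext_of_ne (i + 1) ?_ fun j hj => ?_
      · rw [FinSupp.update_apply_self]
        change (FinSupp.update c i M).1 (i + 1 - 1) = M
        rw [add_sub_cancel_right, FinSupp.update_apply_self]
      · rw [FinSupp.update_apply_of_ne _ hj]
        exact FinSupp.update_apply_of_ne _ (fun h => hj (by rw [← h, sub_add_cancel])) _
    rw [tprod_update_of_eq_one hc, map_mul, ih, registerShift_embed, h, tprod_update_of_eq_one]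
    change c.1 (i + 1 - 1) = 1
    rwa [add_sub_cancel_right]

open Classical in
/-- The shift of register `r` by `k` sites, on one register. -/
def shiftFactor (r : Register) (k : ℤ) (r' : Register) : RegAlg r'.1 →⋆ₐ[ℂ] RegAlg r'.1 :=
  if r' = r then registerShift r'.1 k else StarAlgHom.id ℂ _

theorem shiftFactor_self (r : Register) (k : ℤ) : shiftFactor r k r = registerShift r.1 k :=
  if_pos rfl

theorem shiftFactor_of_ne {r r' : Register} (h : r' ≠ r) (k : ℤ) :
    shiftFactor r k r' = StarAlgHom.id ℂ _ :=
  if_neg h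

theorem shiftFactor_comp (r : Register) {k l : ℤ} (h : k + l = 0) (r' : Register)
    (x : RegAlg r'.1) : shiftFactor r l r' (shiftFactor r k r' x) = x := by
  by_cases hr : r' = r
  · subst hr
    rw [shiftFactor_self, shiftFactor_self, registerShift_comp _ h]
  · rw [shiftFactor_of_ne hr, shiftFactor_of_ne hr]; rfl

/-- The shift of register `r` by `k` sites, on the tensor product of all registers. -/
def hotelShift (r : Register) (k : ℤ) : Hotel →⋆ₐ[ℂ] Hotel :=
  FinTensor.map (A := fun r : Register => RegAlg r.1) (shiftFactor r k)

theorem hotelShift_embed (r : Register) (k : ℤ) (r' : Register) (x : RegAlg r'.1) :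
    hotelShift r k (embed (A := fun r : Register => RegAlg r.1) r' x) =
      embed (A := fun r : Register => RegAlg r.1) r' (shiftFactor r k r' x) :=
  FinTensor.map_embed (A := fun r : Register => RegAlg r.1) _ r' x

theorem hotelShift_comp (r : Register) {k l : ℤ} (h : k + l = 0) :
    (hotelShift r l).comp (hotelShift r k) = StarAlgHom.id ℂ Hotel :=
  FinTensor.hom_ext (A := fun r : Register => RegAlg r.1) fun r' x => by
    rw [StarAlgHom.comp_apply, hotelShift_embed, hotelShift_embed, shiftFactor_comp r h]
    rfl

theorem hotelShift_tprod (r : Register) (a : FinSupp fun r : Register => RegAlg r.1)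
    (c : FinSupp fun _ : ℤ => Mat r.1) :
    hotelShift r 1 (tprod (FinSupp.update a r (tprod c))) =
      tprod (FinSupp.update a r (tprod (shiftFamily c))) := by
  refine (FinTensor.map_tprod (A := fun r : Register => RegAlg r.1) _ _).trans
    (congrArg tprod (FinSupp.ext_of_ne r ?_ fun r' hr => ?_))
  · rw [FinSupp.map_apply, FinSupp.update_apply_self, FinSupp.update_apply_self, shiftFactor_self,
      registerShift_tprod]
  · rw [FinSupp.map_apply, FinSupp.update_apply_of_ne _ hr, FinSupp.update_apply_of_ne _ hr,
      shiftFactor_of_ne hr]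
    rfl

/-- The shift of register `r` as a *-automorphism of the hotel. -/
def hotelShiftEquiv (r : Register) : Hotel ≃⋆ₐ[ℂ] Hotel :=
  StarAlgEquiv.ofStarAlgHom (hotelShift r 1) (hotelShift r (-1)) (hotelShift_comp r (by norm_num))
    (hotelShift_comp r (by norm_num))

/-- The shift of register `r`, fixing the external qubits. -/
def shiftEquiv (r : Register) : MaxTensor Hotel (Mat r.1) ≃⋆ₐ[ℂ] MaxTensor Hotel (Mat r.1) :=
  MaxTensor.congr (hotelShiftEquiv r) (StarAlgEquiv.refl ℂ (Mat r.1))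

theorem shiftEquiv_tmul (r : Register) (a : Hotel) (M : Mat r.1) :
    shiftEquiv r (tmul a M) = tmul (hotelShift r 1 a) M :=
  MaxTensor.congr_tmul _ _ a M

theorem isShift_shiftEquiv (r : Register) : IsShift r (shiftEquiv r) := by
  refine ⟨fun r' hr a => ?_, fun i M => ?_, fun M => ?_⟩
  · rw [shiftEquiv_tmul, hotelShift_embed, shiftFactor_of_ne hr]; rfl
  · unfold site
    rw [shiftEquiv_tmul, hotelShift_embed, shiftFactor_self, registerShift_embed]
  · rw [shiftEquiv_tmul, map_one]

end Shift

/-! ## The swap -/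

section Swap

variable (r : Register)

/-- The embedding of one site as a *-homomorphism. -/
def siteHom (i : ℤ) : Mat r.1 →⋆ₐ[ℂ] Hotel :=
  (embedHom (A := fun r : Register => RegAlg r.1) r).comp (embedHom (A := fun _ : ℤ => Mat r.1) i)

theorem commute_site {i j : ℤ} (h : i ≠ j) (M M' : Mat r.1) :
    Commute (site r i M) (site r j M') :=
  (commute_embed (A := fun _ : ℤ => Mat r.1) h M M').map
    (embedHom (A := fun r : Register => RegAlg r.1) r)

/-- The swap of site `0` with the external qubits, on one site of register `r`. -/
def swapSite (i : ℤ) : Mat r.1 →⋆ₐ[ℂ] MaxTensor Hotel (Mat r.1) :=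
  if i = 0 then MaxTensor.inr Hotel (Mat r.1) else (MaxTensor.inl Hotel (Mat r.1)).comp (siteHom r i)

theorem swapSite_zero (M : Mat r.1) : swapSite r 0 M = tmul 1 M := rfl

theorem swapSite_of_ne {i : ℤ} (h : i ≠ 0) (M : Mat r.1) :
    swapSite r i M = tmul (site r i M) 1 := by
  rw [swapSite, if_neg h]; rfl

theorem commute_tmul_one {A B : Type*} [CStarAlgebra A] [CStarAlgebra B] {a a' : A}
    (h : Commute a a') : Commute (tmul a (1 : B)) (tmul a' 1) :=
  h.map (MaxTensor.inl A B)

theorem commute_swapSite {i j : ℤ} (h : i ≠ j) (M M' : Mat r.1) :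
    Commute (swapSite r i M) (swapSite r j M') := by
  by_cases hi : i = 0
  · subst hi
    rw [swapSite_zero, swapSite_of_ne r (Ne.symm h)]
    exact (MaxTensor.commute_inl_inr _ _).symm
  · rw [swapSite_of_ne r hi]
    by_cases hj : j = 0
    · subst hj
      rw [swapSite_zero]
      exact MaxTensor.commute_inl_inr _ _
    · rw [swapSite_of_ne r hj]
      exact commute_tmul_one (commute_site r h M M')

/-- The swap of site `0` with the external qubits, on register `r`. -/
def swapRegister : RegAlg r.1 →⋆ₐ[ℂ] MaxTensor Hotel (Mat r.1) :=
  FinTensor.lift (A := fun _ : ℤ => Mat r.1) (swapSite r) fun _ _ hij M M' =>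
    commute_swapSite r hij M M'

theorem swapRegister_embed (i : ℤ) (M : Mat r.1) :
    swapRegister r (embed (A := fun _ : ℤ => Mat r.1) i M) = swapSite r i M :=
  FinTensor.lift_embed (A := fun _ : ℤ => Mat r.1) _ _ i M

open Classical in
/-- The swap of site `0` of register `r` with the external qubits, on one register. -/
def swapFactor (r' : Register) : RegAlg r'.1 →⋆ₐ[ℂ] MaxTensor Hotel (Mat r.1) :=
  -- The external matrix algebra is fixed to be that of `r`, so the equality of registers must be
  -- transported in the type.
  if h : r' = r then h ▸ swapRegister r' else
    (MaxTensor.inl Hotel (Mat r.1)).comp (embedHom (A := fun r : Register => RegAlg r.1) r')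

theorem swapFactor_self : swapFactor r r = swapRegister r := by
  rw [swapFactor, dif_pos rfl]

theorem swapFactor_of_ne {r' : Register} (h : r' ≠ r) (x : RegAlg r'.1) :
    swapFactor r r' x = tmul (embed (A := fun r : Register => RegAlg r.1) r' x) 1 := by
  rw [swapFactor, dif_neg h]; rfl

theorem commute_swapRegister {r' : Register} (h : r' ≠ r) (x : RegAlg r.1) (y : RegAlg r'.1) :
    Commute (swapRegister r x) (tmul (embed (A := fun r : Register => RegAlg r.1) r' y) 1) := by
  refine FinTensor.commute_of_forall (A := fun _ : ℤ => Mat r.1) _ _ (fun i M => ?_) x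
  rw [swapRegister_embed]
  by_cases hi : i = 0
  · subst hi
    exact (MaxTensor.commute_inl_inr _ _).symm
  · rw [swapSite_of_ne r hi]
    exact commute_tmul_one (commute_embed (A := fun r : Register => RegAlg r.1) (Ne.symm h) _ _)

theorem commute_swapFactor {r₁ r₂ : Register} (h : r₁ ≠ r₂) (x : RegAlg r₁.1) (y : RegAlg r₂.1) :
    Commute (swapFactor r r₁ x) (swapFactor r r₂ y) := by
  by_cases h₁ : r₁ = r
  · subst h₁
    rw [swapFactor_self, swapFactor_of_ne _ (Ne.symm h)]
    exact commute_swapRegister _ (Ne.symm h) _ _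
  · rw [swapFactor_of_ne _ h₁]
    by_cases h₂ : r₂ = r
    · subst h₂
      rw [swapFactor_self]
      exact (commute_swapRegister _ h _ _).symm
    · rw [swapFactor_of_ne _ h₂]
      exact commute_tmul_one (commute_embed (A := fun r : Register => RegAlg r.1) h _ _)

/-- The swap of site `0` of register `r` with the external qubits, on the hotel. -/
def swapHotel : Hotel →⋆ₐ[ℂ] MaxTensor Hotel (Mat r.1) :=
  FinTensor.lift (A := fun r : Register => RegAlg r.1) (swapFactor r) fun _ _ h x y =>
    commute_swapFactor r h x y

theorem swapHotel_embed (r' : Register) (x : RegAlg r'.1) :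
    swapHotel r (embed (A := fun r : Register => RegAlg r.1) r' x) = swapFactor r r' x :=
  FinTensor.lift_embed (A := fun r : Register => RegAlg r.1) _ _ r' x

/-- After the swap the image of the hotel no longer meets site 0 of `r`, which is free to receive
the external algebra. -/
theorem commute_swapHotel (x : Hotel) (M : Mat r.1) :
    Commute (swapHotel r x) (tmul (site r 0 M) 1) := by
  refine FinTensor.commute_of_forall (A := fun r : Register => RegAlg r.1) _ _ (fun r' x => ?_) x
  rw [swapHotel_embed]
  by_cases hr : r' = r
  · subst hr
    rw [swapFactor_self]
    refine FinTensor.commute_of_forall (A := fun _ : ℤ => Mat r'.1) _ _ (fun i M => ?_) x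
    rw [swapRegister_embed]
    by_cases hi : i = 0
    · subst hi
      exact (MaxTensor.commute_inl_inr _ _).symm
    · rw [swapSite_of_ne _ hi]
      exact commute_tmul_one (commute_site _ hi _ _)
  · rw [swapFactor_of_ne _ hr]
    exact commute_tmul_one (commute_embed (A := fun r : Register => RegAlg r.1) hr _ _)

/-- The swap of site `0` of register `r` with the external qubits, as a *-homomorphism. -/
def swapHom : MaxTensor Hotel (Mat r.1) →⋆ₐ[ℂ] MaxTensor Hotel (Mat r.1) :=
  MaxTensor.lift (swapHotel r) ((MaxTensor.inl Hotel (Mat r.1)).comp (siteHom r 0))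
    fun x M => commute_swapHotel r x M

theorem swapHom_tmul (a : Hotel) (M : Mat r.1) :
    swapHom r (tmul a M) = swapHotel r a * tmul (site r 0 M) 1 :=
  MaxTensor.lift_tmul _ _ _ a M

theorem swapHom_tmul_one (a : Hotel) : swapHom r (tmul a 1) = swapHotel r a := by
  have h : tmul (site r 0 1) (1 : Mat r.1) = 1 :=
    map_one ((MaxTensor.inl Hotel (Mat r.1)).comp (siteHom r 0))
  rw [swapHom_tmul, h, mul_one]

theorem swapHom_one_tmul (M : Mat r.1) : swapHom r (tmul 1 M) = tmul (site r 0 M) 1 := by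
  rw [swapHom_tmul, map_one, one_mul]

theorem swapHom_embed {r' : Register} (hr : r' ≠ r) (x : RegAlg r'.1) :
    swapHom r (tmul (embed (A := fun r : Register => RegAlg r.1) r' x) 1) =
      tmul (embed (A := fun r : Register => RegAlg r.1) r' x) 1 := by
  rw [swapHom_tmul_one, swapHotel_embed, swapFactor_of_ne r hr]

theorem swapHom_site (i : ℤ) (M : Mat r.1) :
    swapHom r (tmul (site r i M) 1) = swapSite r i M := by
  unfold site
  rw [swapHom_tmul_one, swapHotel_embed, swapFactor_self, swapRegister_embed]

theorem swapHom_swapHom_site (i : ℤ) (M : Mat r.1) :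
    swapHom r (swapHom r (tmul (site r i M) 1)) = tmul (site r i M) 1 := by
  rw [swapHom_site]
  by_cases hi : i = 0
  · subst hi
    rw [swapSite_zero, swapHom_one_tmul]
  · rw [swapSite_of_ne r hi, swapHom_site, swapSite_of_ne r hi]

/-- The swap is involutive on the generators, hence everywhere; it is its own inverse and so an
automorphism. -/
theorem swapHom_comp_swapHom : (swapHom r).comp (swapHom r) = StarAlgHom.id ℂ _ := by
  refine MaxTensor.hom_ext (fun a => ?_) fun M => ?_
  · have h : ((swapHom r).comp (swapHom r)).comp (MaxTensor.inl Hotel (Mat r.1)) =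
        MaxTensor.inl Hotel (Mat r.1) := by
      refine FinTensor.hom_ext (A := fun r : Register => RegAlg r.1) fun r' x => ?_
      change swapHom r (swapHom r (tmul _ 1)) = tmul _ 1
      by_cases hr : r' = r
      · subst hr
        have h' : (((swapHom r').comp (swapHom r')).comp (MaxTensor.inl Hotel (Mat r'.1))).comp
            (embedHom (A := fun r : Register => RegAlg r.1) r') =
            (MaxTensor.inl Hotel (Mat r'.1)).comp
              (embedHom (A := fun r : Register => RegAlg r.1) r') :=
          FinTensor.hom_ext (A := fun _ : ℤ => Mat r'.1) fun i M => swapHom_swapHom_site r' i M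
        exact congrArg (fun f => f x) h'
      · rw [swapHom_embed r hr, swapHom_embed r hr]
    exact congrArg (fun f => f a) h
  · rw [StarAlgHom.comp_apply, swapHom_one_tmul, swapHom_site, swapSite_zero]; rfl

/-- The swap of site `0` of register `r` with the external qubits. -/
def swapEquiv : MaxTensor Hotel (Mat r.1) ≃⋆ₐ[ℂ] MaxTensor Hotel (Mat r.1) :=
  StarAlgEquiv.ofStarAlgHom (swapHom r) (swapHom r) (swapHom_comp_swapHom r)
    (swapHom_comp_swapHom r)

theorem swapEquiv_apply (x : MaxTensor Hotel (Mat r.1)) : swapEquiv r x = swapHom r x := rfl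

theorem isSwap_swapEquiv : IsSwap r (swapEquiv r) := by
  refine ⟨fun r' hr a => ?_, fun i hi M => ?_, fun M => ?_, fun M => ?_⟩
  · rw [swapEquiv_apply, swapHom_embed r hr]
  · rw [swapEquiv_apply, swapHom_site, swapSite_of_ne r hi]
  · rw [swapEquiv_apply, swapHom_site, swapSite_zero]
  · rw [swapEquiv_apply, swapHom_one_tmul]

theorem swapRegister_tprod (c : FinSupp fun _ : ℤ => Mat r.1) :
    swapRegister r (tprod c) =
      tmul (embed (A := fun r : Register => RegAlg r.1) r (tprod (FinSupp.update c 0 1)))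
        (c.1 0) := by
  have h := FinTensor.eq_on_tprod_update (A := fun _ : ℤ => Mat r.1) (f := swapRegister r)
    (g := (MaxTensor.inl Hotel (Mat r.1)).comp (embedHom (A := fun r : Register => RegAlg r.1) r))
    0 (fun j hj M => by rw [swapRegister_embed, swapSite_of_ne r hj]; rfl) c
  have hc : tprod c = tprod (FinSupp.update c 0 1) * embed (A := fun _ : ℤ => Mat r.1) 0 (c.1 0) := by
    rw [← tprod_update, FinSupp.update_eq_self]
  rw [hc, map_mul, h, swapRegister_embed, swapSite_zero]
  exact MaxTensor.inl_mul_inr _ _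

/-- On elementary tensors the external matrix and the entry at site 0 simply trade places. This
explicit form feeds the computation of the state. -/
theorem swapHom_tmul_tprod (a : FinSupp fun r : Register => RegAlg r.1)
    (c : FinSupp fun _ : ℤ => Mat r.1) (M : Mat r.1) :
    swapHom r (tmul (tprod (FinSupp.update a r (tprod c))) M) =
      tmul (tprod (FinSupp.update a r (tprod (FinSupp.update c 0 M)))) (c.1 0) := by
  have h : swapHotel r (tprod (FinSupp.update a r 1)) = tmul (tprod (FinSupp.update a r 1)) 1 :=
    FinTensor.eq_on_tprod_update (A := fun r : Register => RegAlg r.1) (f := swapHotel r)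
      (g := MaxTensor.inl Hotel (Mat r.1)) r
      (fun r' hr x => by rw [swapHotel_embed, swapFactor_of_ne r hr]; rfl) a
  have hM : tprod (FinSupp.update c 0 M) =
      tprod (FinSupp.update c 0 1) * embed (A := fun _ : ℤ => Mat r.1) 0 M := tprod_update _ _ _
  have hs : embed (A := fun r : Register => RegAlg r.1) r (tprod (FinSupp.update c 0 M)) =
      embed (A := fun r : Register => RegAlg r.1) r (tprod (FinSupp.update c 0 1)) *
        site r 0 M := by
    rw [hM]
    exact map_mul (embedHom (A := fun r : Register => RegAlg r.1) r) _ _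
  rw [swapHom_tmul, tprod_update, map_mul, h, swapHotel_embed, swapFactor_self,
    swapRegister_tprod, tmul_mul, tmul_mul, one_mul, mul_one, mul_assoc, ← hs, ← tprod_update]

end Swap

/-! ## Exact embezzlement -/

/-- An elementary tensor of the hotel has an arbitrary element of the register algebra at `r`,
possibly only a limit. A second induction in that entry, by continuity and multilinearity, makes it
elementary over the sites. -/
theorem hotel_induction (r : Register) {p : Hotel → Prop} (x : Hotel) (hc : IsClosed {x | p x})
    (htprod : ∀ (a : FinSupp fun r : Register => RegAlg r.1) (c : FinSupp fun _ : ℤ => Mat r.1),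
      p (tprod (FinSupp.update a r (tprod c))))
    (hadd : ∀ x y, p x → p y → p (x + y)) (hsmul : ∀ (c : ℂ) x, p x → p (c • x)) : p x := by
  refine FinTensor.induction x hc (fun a => ?_) hadd hsmul
  have hcont : Continuous fun y : RegAlg r.1 => tprod (FinSupp.update a r y) := by
    have : (fun y : RegAlg r.1 => tprod (FinSupp.update a r y)) = fun y =>
        tprod (FinSupp.update a r 1) * embedHom (A := fun r : Register => RegAlg r.1) r y :=
      funext fun y => tprod_update a r y
    rw [this]
    exact continuous_const.mul (continuous_starAlgHom _)
  have key : p (tprod (FinSupp.update a r (a.1 r))) :=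
    FinTensor.induction (A := fun _ : ℤ => Mat r.1)
      (p := fun y => p (tprod (FinSupp.update a r y))) (a.1 r)
      (hc.preimage hcont) (htprod a)
      (fun x y hx hy => by rw [tprod_update_add]; exact hadd _ _ hx hy)
      fun c x hx => by rw [tprod_update_smul]; exact hsmul _ _ hx
  rwa [FinSupp.update_eq_self] at key

/-- Isolates register `r`: the second factor does not depend on `x` and `y`, so operations on `r`
leave it alone. -/
theorem catalyst_update (r : Register) (a b : FinSupp fun r : Register => RegAlg r.1)
    (x y : RegAlg r.1) :
    catalyst (tmul (tprod (FinSupp.update a r x)) (tprod (FinSupp.update b r y))) =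
      registerState r.2 (tmul x y) *
        ∏ᶠ (t) (_ : t ≠ r), registerState t.2 (tmul (a.1 t) (b.1 t)) := by
  rw [catalyst_tmul_tprod, ← mul_finprod_cond_ne r (hasFiniteMulSupport_zip
    (fun r : Register => registerState r.2) (FinSupp.update a r x) (FinSupp.update b r y)),
    FinSupp.update_apply_self, FinSupp.update_apply_self]
  congr 1
  refine finprod_congr fun t => finprod_congr fun ht => ?_
  rw [FinSupp.update_apply_of_ne _ ht, FinSupp.update_apply_of_ne _ ht]

/-- Shifting in a new pair `M ⊗ M'` at site `1` and reading out the pair at site `0`. -/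
theorem registerState_shift {n : ℕ} (q : SchmidtVec n) (c d : FinSupp fun _ : ℤ => Mat n)
    (M M' : Mat n) :
    registerState q (tmul (tprod (shiftFamily (FinSupp.update c 0 M)))
        (tprod (shiftFamily (FinSupp.update d 0 M')))) *
        (expectZero (c.1 0) * expectZero (d.1 0)) =
      registerState q (tmul (tprod c) (tprod d)) * expect q.ket M M' := by
  have hF := hasFiniteMulSupport_zip (siteState q) c d
  have hG := hasFiniteMulSupport_zip (fun i => siteState q (i + 1)) (FinSupp.update c 0 M)
    (FinSupp.update d 0 M')
  have hzero : siteState q 0 (tmul (c.1 0) (d.1 0)) = expectZero (c.1 0) * expectZero (d.1 0) := by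
    rw [siteState_tmul, if_pos le_rfl]
  have hone : siteState q (0 + 1) (tmul M M') = expect q.ket M M' := by
    rw [siteState_tmul, if_neg (by norm_num)]
  have hrest : ∀ i : ℤ, i ≠ 0 → siteState q (i + 1) (tmul ((FinSupp.update c 0 M).1 i)
      ((FinSupp.update d 0 M').1 i)) = siteState q i (tmul (c.1 i) (d.1 i)) := fun i hi => by
    rw [FinSupp.update_apply_of_ne _ hi, FinSupp.update_apply_of_ne _ hi]
    -- For an integer `i ≠ 0`, `i + 1 ≤ 0` holds exactly when `i ≤ 0`. Only the step from site 0 to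
    -- site 1 changes the vector.
    have : siteState q (i + 1) = siteState q i := by
      unfold siteState
      exact if_congr (by omega) rfl rfl
    rw [this]
  have hshift : registerState q (tmul (tprod (shiftFamily (FinSupp.update c 0 M)))
      (tprod (shiftFamily (FinSupp.update d 0 M')))) = ∏ᶠ i : ℤ, siteState q (i + 1)
        (tmul ((FinSupp.update c 0 M).1 i) ((FinSupp.update d 0 M').1 i)) := by
    -- Reindexing by `i ↦ i + 1` undoes the shift of the entries and displaces the states instead.
    rw [registerState_tmul_tprod, ← finprod_comp_equiv (Equiv.addRight (1 : ℤ))]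
    refine finprod_congr fun i => ?_
    change siteState q (i + 1) (tmul ((FinSupp.update c 0 M).1 (i + 1 - 1))
      ((FinSupp.update d 0 M').1 (i + 1 - 1))) = _
    rw [add_sub_cancel_right]
  -- Both products are split at `i = 0`. The remaining products agree, and the factors split off are
  -- the ones on the opposite sides of the claim.
  rw [hshift, ← mul_finprod_cond_ne 0 hG, registerState_tmul_tprod, ← mul_finprod_cond_ne 0 hF,
    FinSupp.update_apply_self, FinSupp.update_apply_self, hone, hzero,
    finprod_congr fun i => finprod_congr fun hi => hrest i hi]
  ring

variable {n : ℕ}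

/-- The state `s ⊗ s₀ ⊗ s₀` on `(A ⊗ M) ⊗ (B ⊗ M)`. -/
def inputState {A B : Type} [CStarAlgebra A] [CStarAlgebra B] (n : ℕ) (s : CState (MaxTensor A B)) :
    CState (MaxTensor (MaxTensor A (Mat n)) (MaxTensor B (Mat n))) :=
  (tensorState s (pairState (ketZero n) ketZero_unit)).comap MaxTensor.interchange

theorem inputState_tmul {A B : Type} [CStarAlgebra A] [CStarAlgebra B]
    (s : CState (MaxTensor A B)) (a : A) (M : Mat n) (b : B) (M' : Mat n) :
    inputState n s (tmul (tmul a M) (tmul b M')) =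
      s (tmul a b) * (expectZero M * expectZero M') := by
  rw [inputState, CState.comap_apply, MaxTensor.interchange_tmul, tensorState_tmul,
    pairState_tmul, expect_ketZero]

theorem applyUnitary_tmul (A : Type*) [CStarAlgebra A]
    (U : Matrix.unitaryGroup (Fin (2 ^ n)) ℂ) (a : A) (M : Mat n) :
    applyUnitary A U (tmul a M) = tmul a (star U.1 * M * U.1) := by
  unfold applyUnitary
  rw [Unitary.conjStarAlgAut_apply, tmul_mul, star_tmul, tmul_mul, star_star, star_one, one_mul,
    mul_one]

/-- Both sides are linear and continuous in `a` and in `b`, so `hotel_induction` reduces to tensors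
on which swap and shift act explicitly. There `registerState_shift` applies to the factor of `r`. -/
theorem embezzle_tmul (r : Register) (a b : Hotel) (M M' : Mat r.1) :
    inputState r.1 catalyst (tmul (shiftEquiv r (swapEquiv r (tmul a M)))
      (shiftEquiv r (swapEquiv r (tmul b M')))) =
      catalyst (tmul a b) * expect r.2.ket M M' := by
  have hl : ∀ (M : Mat r.1), Continuous fun a : Hotel =>
      shiftEquiv r (swapEquiv r (tmul a M)) := fun M =>
    (continuous_starAlgHom (shiftEquiv r).toStarAlgHom).comp
      ((continuous_starAlgHom (swapHom r)).comp (MaxTensor.continuous_tmul_left M))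
  refine hotel_induction r (p := fun a => inputState r.1 catalyst
    (tmul (shiftEquiv r (swapEquiv r (tmul a M))) (shiftEquiv r (swapEquiv r (tmul b M')))) =
      catalyst (tmul a b) * expect r.2.ket M M') a
    (isClosed_eq ((inputState r.1 catalyst).continuous.comp
        ((MaxTensor.continuous_tmul_left _).comp (hl M)))
      ((catalyst.continuous.comp (MaxTensor.continuous_tmul_left b)).mul continuous_const))
    (fun a c => ?_) ?_ ?_
  · refine hotel_induction r (p := fun b => inputState r.1 catalyst
      (tmul (shiftEquiv r (swapEquiv r (tmul (tprod (FinSupp.update a r (tprod c))) M)))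
        (shiftEquiv r (swapEquiv r (tmul b M')))) =
        catalyst (tmul (tprod (FinSupp.update a r (tprod c))) b) * expect r.2.ket M M') b
      (isClosed_eq ((inputState r.1 catalyst).continuous.comp
          ((MaxTensor.continuous_tmul_right _).comp (hl M')))
        ((catalyst.continuous.comp (MaxTensor.continuous_tmul_right _)).mul continuous_const))
      (fun b d => ?_) ?_ ?_
    · rw [swapEquiv_apply, swapEquiv_apply, swapHom_tmul_tprod, swapHom_tmul_tprod,
        shiftEquiv_tmul, shiftEquiv_tmul, hotelShift_tprod, hotelShift_tprod, inputState_tmul,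
        catalyst_update, catalyst_update, mul_right_comm, registerState_shift]
      ring
    · intro x y hx hy
      rw [MaxTensor.add_tmul, map_add, map_add, MaxTensor.tmul_add, map_add, hx, hy,
        MaxTensor.tmul_add, map_add, add_mul]
    · intro z x hx
      rw [MaxTensor.smul_tmul, map_smul, map_smul, MaxTensor.tmul_smul, map_smul, hx,
        MaxTensor.tmul_smul, map_smul, smul_mul_assoc]
  · intro x y hx hy
    rw [MaxTensor.add_tmul, map_add, map_add, MaxTensor.add_tmul, map_add, hx, hy,
      MaxTensor.add_tmul, map_add, add_mul]
  · intro z x hx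
    rw [MaxTensor.smul_tmul, map_smul, map_smul, MaxTensor.smul_tmul, map_smul, hx,
      MaxTensor.smul_tmul, map_smul, smul_mul_assoc]

/-- The state `ω` is taken to be the pullback of `ω₀` along `γ`, so the final identity holds by
definition. The content lies in checking that this pullback has the values of `s ⊗ s_φ` on
elementary tensors. -/
theorem embezzles_catalyst (n : ℕ+) (q : SchmidtVec n)
    (U V : Matrix.unitaryGroup (Fin (2 ^ (n : ℕ))) ℂ) :
    Embezzles catalyst (localRotate U.1 V.1 q.ket)
      (((applyUnitary Hotel U).trans (swapEquiv ⟨n, q⟩)).trans (shiftEquiv ⟨n, q⟩))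
      (((applyUnitary Hotel V).trans (swapEquiv ⟨n, q⟩)).trans (shiftEquiv ⟨n, q⟩)) := by
  set α := ((applyUnitary Hotel U).trans (swapEquiv ⟨n, q⟩)).trans (shiftEquiv ⟨n, q⟩)
  set β := ((applyUnitary Hotel V).trans (swapEquiv ⟨n, q⟩)).trans (shiftEquiv ⟨n, q⟩)
  refine ⟨MaxTensor.congr α β, inputState n catalyst,
    (inputState n catalyst).comap (MaxTensor.congr α β).toStarAlgHom,
    MaxTensor.congr_tmul α β, inputState_tmul catalyst, fun a M b M' => ?_, fun X => rfl⟩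
  rw [CState.comap_apply]
  change inputState n catalyst (MaxTensor.congr α β (tmul (tmul a M) (tmul b M'))) = _
  rw [MaxTensor.congr_tmul, expect_localRotate]
  have hα : α (tmul a M) = shiftEquiv ⟨n, q⟩ (swapEquiv ⟨n, q⟩ (tmul a (star U.1 * M * U.1))) := by
    rw [← applyUnitary_tmul]; rfl
  have hβ : β (tmul b M') =
      shiftEquiv ⟨n, q⟩ (swapEquiv ⟨n, q⟩ (tmul b (star V.1 * M' * V.1))) := by
    rw [← applyUnitary_tmul]; rfl
  rw [hα, hβ]
  exact embezzle_tmul ⟨n, q⟩ a b _ _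

end Embezzlement

end

open Embezzlement
theorem theorem4 :
    ¬ TopologicalSpace.SeparableSpace Hotel ∧
    ∃ (s : CState (MaxTensor Hotel Hotel))
      (π τ : ∀ r : Register, MaxTensor Hotel (Mat r.1) ≃⋆ₐ[ℂ] MaxTensor Hotel (Mat r.1)),
      IsCatalyst s ∧ (∀ r, IsShift r (π r)) ∧ (∀ r, IsSwap r (τ r)) ∧
      ∀ (n : ℕ+) (φ : BiVec n), ∑ p, ‖φ p‖ ^ 2 = 1 →
        (∃ (q : SchmidtVec n) (U V : Matrix.unitaryGroup (Fin (2 ^ (n : ℕ))) ℂ),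
          φ = localRotate U.1 V.1 q.ket) ∧
        ∀ (q : SchmidtVec n) (U V : Matrix.unitaryGroup (Fin (2 ^ (n : ℕ))) ℂ),
          φ = localRotate U.1 V.1 q.ket →
          Embezzles s φ
            (((applyUnitary Hotel U).trans (τ ⟨n, q⟩)).trans (π ⟨n, q⟩))
            (((applyUnitary Hotel V).trans (τ ⟨n, q⟩)).trans (π ⟨n, q⟩)) := by
  refine ⟨not_separableSpace_hotel, catalyst, shiftEquiv, swapEquiv, isCatalyst_catalyst,
    isShift_shiftEquiv, isSwap_swapEquiv, fun n φ hφ => ⟨exists_schmidt φ hφ, ?_⟩⟩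
  rintro q U V rfl
  exact embezzles_catalyst n q U V
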